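/- Let $G$ be a finite simple graph with vertex set $V$. Its fractional stable set polytope is $\mathrm{FRAC}(G)=\{x\in[0,1]^V : x_i+x_j\le 1 \text{ for every edge } \{i,j\}\}$. For $P\subseteq[0,1]^V$ let $P_I=\mathrm{conv}(P\cap\{0,1\}^V)$ and $\mathrm{cone}(P)=\{(\lambda,\lambda x)\in\mathbb R^{\{0\}\cup V}:\lambda\ge 0,\ x\in P\}$. Let $\mathrm{LS}_+(P)$ be the set of all $x\in\mathbb R^V$ for which there is a real symmetric positive semidefinite matrix $Y$ indexed by $\{0\}\cup V$ with $Ye_0=\mathrm{diag}(Y)=(1,x)$ and $Ye_i,\ Y(e_0-e_i)\in\mathrm{cone}(P)$ for all $i\in V$. Put $\mathrm{LS}_+^0(P)=P$ and $\mathrm{LS}_+^{m}(P)=\mathrm{LS}_+(\mathrm{LS}_+^{m-1}(P))$ for $m\ge 1$. The $\mathrm{LS}_+$-rank $r_+(G)$ of $G$ is the smallest integer $m\ge 0$ with $\mathrm{LS}_+^m(\mathrm{FRAC}(G))=\mathrm{FRAC}(G)_I$ (such an $m$ exists). A graph is vertex-transitive if for any two vertices $u,v$ some automorphism maps $u$ to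 $v$. For odd $k\ge 3$ let $\mathcal B_k$ be the graph on the $4k$ vertices $i_0,i_1,i_2,i_3$, $i\in\mathbb Z/k\mathbb Z$, with edges $\{i_0,i_1\},\{i_1,i_2\},\{i_2,i_3\},\{i_3,i_0\}$ for all $i$, together with $\{i_0,j_2\}$ and $\{i_1,j_3\}$ for all $i,j$ such that $j-i$ is congruent modulo $k$ to an element of $\{1,2,\dots,\frac{k-1}{2}\}$. **Theorem.** For every odd integer $k\ge 3$, the graph $\mathcal B_k$ is vertex-transitive and $r_+(\mathcal B_k)\ge k-2$. Moreover, for every positive integer $\ell$ there is a vertex-transitive graph $G$ with $|V(G)|\le 4\ell+12$ and $r_+(G)\ge\ell$. -/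

import Mathlib

/-! The index `0` of the paper's vectors in `ℝ ^ (n + 1)` is `none : Option V`, and a coordinate
`i : V` is `some i`. -/

/-- The homogenized cone of `P`: all vectors `(t, t x)` with `t ≥ 0` and `x ∈ P`. -/
def homogCone {V : Type*} (P : Set (V → ℝ)) : Set (Option V → ℝ) :=
  {y | ∃ t : ℝ, 0 ≤ t ∧ ∃ x ∈ P, y none = t ∧ ∀ i : V, y (some i) = t * x i}

/-- The lifted set: symmetric positive semidefinite matrices `Y` with `Y e₀ = diag Y` such that
`Y eᵢ` and `Y (e₀ - eᵢ)` lie in the homogenized cone of `P` for all `i`. -/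
def liftLSPlus {V : Type*} (P : Set (V → ℝ)) : Set (Matrix (Option V) (Option V) ℝ) :=
  {Y | Y.PosSemidef ∧ Y.col none = Y.diag ∧
    ∀ i : V, Y.col (some i) ∈ homogCone P ∧ Y.col none - Y.col (some i) ∈ homogCone P}

/-- The Lovász–Schrijver operator `LS₊`. -/
def LSPlus {V : Type*} (P : Set (V → ℝ)) : Set (V → ℝ) :=
  {x | ∃ Y ∈ liftLSPlus P, Y none none = 1 ∧ ∀ i : V, Y (some i) none = x i}

/-- The integer hull of `P ⊆ [0,1]ⁿ`. -/
def integerHull {V : Type*} (P : Set (V → ℝ)) : Set (V → ℝ) :=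
  convexHull ℝ (P ∩ {x | ∀ i : V, x i = 0 ∨ x i = 1})

/-- The `LS₊`-rank of a set `P ⊆ [0,1]ⁿ`: the least `m` with `LS₊ᵐ(P) = P_I`. (If there were no such
`m`, this would be `0`, so a positive lower bound on it includes that the iteration reaches the
integer hull.) -/
noncomputable def LSPlusRank {V : Type*} (P : Set (V → ℝ)) : ℕ :=
  sInf {m : ℕ | LSPlus^[m] P = integerHull P}

namespace SimpleGraph

/-- The fractional stable set polytope. -/
def fracPolytope {V : Type*} (G : SimpleGraph V) : Set (V → ℝ) :=
  {x | (∀ i : V, 0 ≤ x i ∧ x i ≤ 1) ∧ ∀ i j : V, G.Adj i j → x i + x j ≤ 1}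

/-- The `LS₊`-rank `r₊(G)` of a graph. Here the integer hull of `G.fracPolytope` is the stable set
polytope of `G`. -/
noncomputable def lsPlusRank {V : Type*} (G : SimpleGraph V) : ℕ :=
  LSPlusRank G.fracPolytope

/-- The automorphism group acts transitively on the vertices. -/
def IsVertexTransitive {V : Type*} (G : SimpleGraph V) : Prop :=
  ∀ u v : V, ∃ φ : G ≃g G, φ u = v

end SimpleGraph

/-- The edges of `B_k`, each listed in one orientation. The vertex `i_a` is the pair `(i, a)`.
Subtraction in `Fin k` is cyclic, so `(j - i : Fin k).val` is the residue of `j - i` modulo `k`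
in `{0, …, k - 1}`. -/
def edgeRelB (k : ℕ) (u v : Fin k × Fin 4) : Prop :=
  (u.1 = v.1 ∧
    ((u.2 = 0 ∧ v.2 = 1) ∨ (u.2 = 1 ∧ v.2 = 2) ∨ (u.2 = 2 ∧ v.2 = 3) ∨ (u.2 = 3 ∧ v.2 = 0))) ∨
  (((u.2 = 0 ∧ v.2 = 2) ∨ (u.2 = 1 ∧ v.2 = 3)) ∧
    1 ≤ (v.1 - u.1 : Fin k).val ∧ (v.1 - u.1 : Fin k).val ≤ (k - 1) / 2)

/-- The graph `B_k` (used for odd `k ≥ 3`). -/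
def graphB (k : ℕ) : SimpleGraph (Fin k × Fin 4) :=
  SimpleGraph.fromRel (edgeRelB k)

/-! With the coordinates `(i, 3)` set to zero, what remains of `graphB k` is a clique on `k`
vertices, each stretched to a path `(i, 0), (i, 1), (i, 2)`, whose ends are joined according to the
rotational tournament. A stable set contains both ends of at most one path, so `pathSum x ≤ k + 1`
is valid on the integer hull (`pathSum_le_of_mem_integerHull`). The lower bound follows once a point
of the relaxation of index `k - 3` violates this inequality, since the iterates decrease and do
reach the integer hull (`lt_LSPlusRank`).

Violating points are built by induction on the number of active paths. For three paths the
all-halves point works. In the induction step (`HasBeyondPoint.step`) let `A` be the sum of the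
matrices `z zᵀ` over the tight stable sets `z`; its first column satisfies the inequality with
equality. The matrix `A - ε B` violates it when the first column of `B` has negative `excess`. It
stays positive semidefinite for small `ε` because the form of `B` is bounded by a multiple of that
of `A` (`posSemidef_tightMatrix_sub`). Its columns stay in the cone because the tight sets of a
clique with one path fewer occur in the matching column of `A`: they span the hyperplane `excess =
0` of that smaller clique's linear hull, and the violating point given by induction opens the
missing direction `-midVec` (`feasDir_neg_midVec`).

The spanning property requires every stretched vertex to have an active in-neighbour and an active
out-neighbour. Deletions can destroy this, so some vertices are unstretched along the way. In a
locally transitive tournament three unstretched vertices always suffice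
(`hasBeyondPoint_of_transitive`, `IsLocallyTransitive.hasBeyondPoint`). -/

/-! ### The homogenized cone and the operator `LS₊` -/

/-- The vector `(1, x)`. -/
def homogVec {V : Type*} (x : V → ℝ) : Option V → ℝ := fun o => o.elim 1 x

@[simp] theorem homogVec_none {V : Type*} (x : V → ℝ) : homogVec x none = 1 := rfl

@[simp] theorem homogVec_some {V : Type*} (x : V → ℝ) (i : V) : homogVec x (some i) = x i := rfl

section LSPlus

variable {V : Type*} {P Q : Set (V → ℝ)}

theorem homogCone_mono (h : P ⊆ Q) : homogCone P ⊆ homogCone Q := by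
  rintro y ⟨t, ht, x, hx, h0, h1⟩
  exact ⟨t, ht, x, h hx, h0, h1⟩

theorem homogVec_mem_homogCone {x : V → ℝ} (hx : x ∈ P) : homogVec x ∈ homogCone P :=
  ⟨1, zero_le_one, x, hx, rfl, fun i => by simp⟩

theorem smul_mem_homogCone {y : Option V → ℝ} (hy : y ∈ homogCone P) {a : ℝ} (ha : 0 ≤ a) :
    a • y ∈ homogCone P := by
  obtain ⟨t, ht, x, hx, h0, h1⟩ := hy
  exact ⟨a * t, mul_nonneg ha ht, x, hx, by simp [h0], fun i => by simp [h1, mul_assoc]⟩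

theorem zero_mem_homogCone (hP : P.Nonempty) : (0 : Option V → ℝ) ∈ homogCone P := by
  obtain ⟨x, hx⟩ := hP
  exact ⟨0, le_rfl, x, hx, rfl, fun i => by simp⟩

theorem add_mem_homogCone (hP : Convex ℝ P) {y z : Option V → ℝ} (hy : y ∈ homogCone P)
    (hz : z ∈ homogCone P) : y + z ∈ homogCone P := by
  obtain ⟨t, ht, x, hx, h0, h1⟩ := hy
  obtain ⟨s, hs, x', hx', h0', h1'⟩ := hz
  rcases eq_or_lt_of_le (add_nonneg ht hs) with h | h
  · have ht0 : t = 0 := by linarith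
    have hs0 : s = 0 := by linarith
    exact ⟨0, le_rfl, x, hx, by simp [h0, h0', ht0, hs0],
      fun i => by simp [h1, h1', ht0, hs0]⟩
  · refine ⟨t + s, h.le, (t / (t + s)) • x + (s / (t + s)) • x',
      hP hx hx' (by positivity) (by positivity) (by field_simp), by simp [h0, h0'], fun i => ?_⟩
    simp only [Pi.add_apply, h1, h1', Pi.smul_apply, smul_eq_mul]
    field_simp

theorem homogVec_mem_homogCone_iff {x : V → ℝ} : homogVec x ∈ homogCone P ↔ x ∈ P := by
  refine ⟨?_, homogVec_mem_homogCone⟩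
  rintro ⟨t, -, y, hy, h0, h1⟩
  have ht : t = 1 := by simpa using h0.symm
  have : x = y := funext fun i => by simpa [ht] using h1 i
  rwa [this]

theorem liftLSPlus_mono (h : P ⊆ Q) : liftLSPlus P ⊆ liftLSPlus Q := fun _ hY =>
  ⟨hY.1, hY.2.1, fun i => ⟨homogCone_mono h (hY.2.2 i).1, homogCone_mono h (hY.2.2 i).2⟩⟩

theorem LSPlus_mono : Monotone (LSPlus : Set (V → ℝ) → Set (V → ℝ)) := by
  rintro P Q h x ⟨Y, hY, h0, h1⟩
  exact ⟨Y, liftLSPlus_mono h hY, h0, h1⟩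

theorem convex_LSPlus (hP : Convex ℝ P) : Convex ℝ (LSPlus P) := by
  rintro x ⟨Y, ⟨hY, hYd, hYc⟩, h0, h1⟩ x' ⟨Y', ⟨hY', hYd', hYc'⟩, h0', h1'⟩ a b ha hb hab
  refine ⟨a • Y + b • Y', ⟨(hY.smul ha).add (hY'.smul hb), ?_, fun i => ⟨?_, ?_⟩⟩, ?_, ?_⟩
  · ext o
    have e := congrFun hYd o
    have e' := congrFun hYd' o
    simp only [Matrix.col_apply, Matrix.diag_apply] at e e'
    simp [e, e']
  · have := add_mem_homogCone hP (smul_mem_homogCone (hYc i).1 ha)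
      (smul_mem_homogCone (hYc' i).1 hb)
    exact this
  · have := add_mem_homogCone hP (smul_mem_homogCone (hYc i).2 ha)
      (smul_mem_homogCone (hYc' i).2 hb)
    convert this using 1
    ext o
    simp only [Pi.sub_apply, Matrix.col_apply, Matrix.add_apply, Matrix.smul_apply, smul_eq_mul,
      Pi.add_apply, Pi.smul_apply]
    ring
  · simp [h0, h0', hab]
  · simp [h1, h1']

theorem LSPlus_subset [Nonempty V] (hP : Convex ℝ P) : LSPlus P ⊆ P := by
  rintro x ⟨Y, ⟨-, -, hYc⟩, h0, h1⟩
  obtain ⟨i⟩ := ‹Nonempty V›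
  have h := add_mem_homogCone hP (hYc i).1 (hYc i).2
  rw [add_sub_cancel] at h
  rw [← homogVec_mem_homogCone_iff]
  convert h using 1
  ext o
  cases o with
  | none => simp [h0]
  | some j => simp [h1]

theorem mem_LSPlus_of_integral [Finite V] {x : V → ℝ} (hx : x ∈ P) (h01 : ∀ i, x i = 0 ∨ x i = 1) :
    x ∈ LSPlus P := by
  refine ⟨Matrix.vecMulVec (homogVec x) (homogVec x), ⟨?_, ?_, fun i => ?_⟩, by
    simp [Matrix.vecMulVec_apply], fun i => by simp [Matrix.vecMulVec_apply]⟩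
  · simpa using Matrix.posSemidef_vecMulVec_self_star (homogVec x)
  · ext o
    cases o with
    | none => simp [Matrix.vecMulVec_apply]
    | some j => rcases h01 j with h | h <;> simp [Matrix.vecMulVec_apply, h]
  · have e0 : (Matrix.vecMulVec (homogVec x) (homogVec x)).col none = homogVec x := by
      ext o; simp [Matrix.vecMulVec_apply]
    have e1 : (Matrix.vecMulVec (homogVec x) (homogVec x)).col (some i) = x i • homogVec x := by
      ext o; simp [Matrix.vecMulVec_apply, mul_comm]
    rw [e0, e1]
    rcases h01 i with h | h
    · simpa [h] using And.intro (zero_mem_homogCone ⟨x, hx⟩) (homogVec_mem_homogCone hx)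
    · simpa [h] using And.intro (homogVec_mem_homogCone hx) (zero_mem_homogCone ⟨x, hx⟩)

theorem normalized_mem_LSPlus {Y : Matrix (Option V) (Option V) ℝ} (hY : Y ∈ liftLSPlus P)
    (h0 : 0 < Y none none) : (fun i => Y (some i) none / Y none none) ∈ LSPlus P := by
  obtain ⟨hY, hYd, hYc⟩ := hY
  have hc : 0 ≤ (Y none none)⁻¹ := by positivity
  refine ⟨(Y none none)⁻¹ • Y, ⟨hY.smul hc, ?_, fun i => ⟨?_, ?_⟩⟩, ?_, ?_⟩
  · ext o
    have e := congrFun hYd o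
    simp only [Matrix.col_apply, Matrix.diag_apply] at e
    simp [e]
  · exact smul_mem_homogCone (hYc i).1 hc
  · have := smul_mem_homogCone (hYc i).2 hc
    rwa [smul_sub] at this
  · simp [h0.ne']
  · intro i
    simp [div_eq_inv_mul]

theorem convex_LSPlus_iterate (hP : Convex ℝ P) (m : ℕ) : Convex ℝ (LSPlus^[m] P) := by
  induction m with
  | zero => exact hP
  | succ m ih =>
    rw [Function.iterate_succ_apply']
    exact convex_LSPlus ih

theorem LSPlus_iterate_mono (m : ℕ) (h : P ⊆ Q) : LSPlus^[m] P ⊆ LSPlus^[m] Q :=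
  LSPlus_mono.iterate m h

theorem LSPlus_iterate_antitone [Nonempty V] (hP : Convex ℝ P) :
    Antitone fun m => LSPlus^[m] P := by
  refine antitone_nat_of_succ_le fun m => ?_
  rw [Function.iterate_succ_apply']
  exact LSPlus_subset (convex_LSPlus_iterate hP m)

theorem LSPlus_iterate_subset [Nonempty V] (hP : Convex ℝ P) (m : ℕ) : LSPlus^[m] P ⊆ P :=
  LSPlus_iterate_antitone hP (Nat.zero_le m)

theorem mem_LSPlus_iterate_of_integral [Finite V] {x : V → ℝ} (hx : x ∈ P) (h01 : ∀ i, x i = 0 ∨ x i = 1)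
    (m : ℕ) : x ∈ LSPlus^[m] P := by
  induction m with
  | zero => exact hx
  | succ m ih =>
    rw [Function.iterate_succ_apply']
    exact mem_LSPlus_of_integral ih h01

theorem integerHull_subset_LSPlus_iterate [Finite V] (hP : Convex ℝ P) (m : ℕ) :
    integerHull P ⊆ LSPlus^[m] P :=
  convexHull_min (fun _ hx => mem_LSPlus_iterate_of_integral hx.1 hx.2 m)
    (convex_LSPlus_iterate hP m)

/-! ### Finiteness of the rank -/

/-- If a convex combination attains the lower bound `c`, every point of nonzero weight must attain
it too. -/
theorem mem_convexHull_inter_of_linear_eq_zero {E : Type*} [AddCommGroup E] [Module ℝ E]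
    {A : Set E} (L : E →ₗ[ℝ] ℝ) (c : ℝ) (hA : ∀ a ∈ A, c ≤ L a) {x : E}
    (hx : x ∈ convexHull ℝ A) (hL : L x = c) : x ∈ convexHull ℝ (A ∩ {a | L a = c}) := by
  classical
  rw [_root_.convexHull_eq] at hx
  obtain ⟨ι, t, w, z, hw0, hw1, hz, rfl⟩ := hx
  rw [Finset.centerMass_eq_of_sum_1 _ _ hw1] at hL ⊢
  have hsum : ∑ i ∈ t, w i * (L (z i) - c) = 0 := by
    have : ∑ i ∈ t, w i * (L (z i) - c) = L (∑ i ∈ t, w i • z i) - (∑ i ∈ t, w i) * c := by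
      rw [map_sum, Finset.sum_mul, ← Finset.sum_sub_distrib]
      exact Finset.sum_congr rfl fun i _ => by rw [map_smul, smul_eq_mul]; ring
    rw [this, hL, hw1]; ring
  have hterm : ∀ i ∈ t, w i * (L (z i) - c) = 0 :=
    (Finset.sum_eq_zero_iff_of_nonneg fun i hi =>
      mul_nonneg (hw0 i hi) (sub_nonneg.2 (hA _ (hz i hi)))).1 hsum
  have hs : ∑ i ∈ t, w i • z i = ∑ i ∈ t.filter (fun i => w i ≠ 0), w i • z i := by
    symm
    refine Finset.sum_filter_of_ne fun i _ h hw => h (by simp [hw])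
  have hs1 : ∑ i ∈ t.filter (fun i => w i ≠ 0), w i = 1 := by
    rw [Finset.sum_filter_ne_zero, hw1]
  rw [hs]
  refine (convex_convexHull ℝ _).sum_mem (fun i hi => hw0 i (Finset.mem_filter.1 hi).1) hs1
    fun i hi => subset_convexHull ℝ _ ?_
  obtain ⟨hi, hwi⟩ := Finset.mem_filter.1 hi
  refine ⟨hz i hi, ?_⟩
  have := (mul_eq_zero.1 (hterm i hi)).resolve_left hwi
  exact sub_eq_zero.1 this

/-- The first column is `Y eᵢ + Y (e₀ - eᵢ)`. Symmetry and the diagonal condition force coordinate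
`i` to be `1` in the normalized first summand and `0` in the second. -/
theorem LSPlus_subset_convexHull_coord (i : V) :
    LSPlus P ⊆ convexHull ℝ (P ∩ {x | x i = 0} ∪ P ∩ {x | x i = 1}) := by
  rintro x ⟨Y, ⟨hY, hYd, hYc⟩, h0, h1⟩
  obtain ⟨⟨t, ht, y, hy, a0, a1⟩, ⟨s, hs, z, hz, b0, b1⟩⟩ := hYc i
  have hsymm : ∀ a b, Y a b = Y b a := fun a b => by simpa using hY.isHermitian.apply b a
  have hii : Y (some i) none = Y (some i) (some i) := by
    simpa using congrFun hYd (some i)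
  simp only [Matrix.col_apply, Pi.sub_apply] at a0 a1 b0 b1
  have hts : t + s = 1 := by rw [← a0, ← b0, h0]; ring
  have hx : x = t • y + s • z := by
    ext j
    simp only [Pi.add_apply, Pi.smul_apply, smul_eq_mul]
    rw [← a1, ← b1, ← h1]; ring
  have hyi : t * y i = t := by
    rw [← a1, ← a0, ← hii, hsymm]
  have hzi : s * z i = 0 := by
    rw [← b1, hii]; ring
  rcases eq_or_ne t 0 with ht0 | ht0
  · have hs1 : s = 1 := by linarith
    have : x = z := by rw [hx, ht0, hs1]; simp
    rw [this]
    exact subset_convexHull ℝ _ (Or.inl ⟨hz, by simpa [hs1] using hzi⟩)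
  rcases eq_or_ne s 0 with hs0 | hs0
  · have ht1 : t = 1 := by linarith
    have : x = y := by rw [hx, hs0, ht1]; simp
    rw [this]
    exact subset_convexHull ℝ _ (Or.inr ⟨hy, by simpa [ht1] using hyi⟩)
  rw [hx]
  have hy1 : y i = 1 := mul_left_cancel₀ ht0 (by simpa using hyi)
  have hz0 : z i = 0 := (mul_eq_zero.1 hzi).resolve_left hs0
  exact convex_convexHull ℝ (P ∩ {x | x i = 0} ∪ P ∩ {x | x i = 1})
    (subset_convexHull ℝ _ (Or.inr ⟨hy, hy1⟩))
    (subset_convexHull ℝ _ (Or.inl ⟨hz, hz0⟩)) ht hs hts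

/-- Each application makes one more coordinate integral. Coordinates treated earlier stay integral
because `x i = 0` and `x i = 1` cut out faces of the previous convex hull. -/
theorem LSPlus_iterate_subset_convexHull
    (hP : ∀ x ∈ P, ∀ i, 0 ≤ x i ∧ x i ≤ 1) (J : Finset V) :
    LSPlus^[J.card] P ⊆ convexHull ℝ (P ∩ {x | ∀ i ∈ J, x i = 0 ∨ x i = 1}) := by
  classical
  induction J using Finset.induction_on with
  | empty => simpa using subset_convexHull ℝ P
  | insert i J hi ih =>
    rw [Finset.card_insert_of_notMem hi, Function.iterate_succ_apply']
    refine (LSPlus_subset_convexHull_coord i).trans (convexHull_min ?_ (convex_convexHull ℝ _))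
    rintro x (⟨hx, hxi⟩ | ⟨hx, hxi⟩)
    · have := mem_convexHull_inter_of_linear_eq_zero (LinearMap.proj (R := ℝ) (φ := fun _ : V => ℝ) i) 0
        (fun a ha => (hP a ha.1 i).1) (ih hx) hxi
      refine convexHull_mono ?_ this
      rintro a ⟨⟨ha, haJ⟩, hai⟩
      exact ⟨ha, fun j hj => (Finset.mem_insert.1 hj).elim (fun h => h ▸ Or.inl hai) (haJ j)⟩
    · have := mem_convexHull_inter_of_linear_eq_zero (-LinearMap.proj (R := ℝ) (φ := fun _ : V => ℝ) i) (-1)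
        (fun a ha => by simpa using (hP a ha.1 i).2) (ih hx)
        (by simpa using congrArg Neg.neg hxi)
      refine convexHull_mono ?_ this
      rintro a ⟨⟨ha, haJ⟩, hai⟩
      have hai : a i = 1 := by simpa using hai
      exact ⟨ha, fun j hj => (Finset.mem_insert.1 hj).elim (fun h => h ▸ Or.inr hai) (haJ j)⟩

theorem LSPlus_iterate_card_eq_integerHull [Fintype V] (hc : Convex ℝ P)
    (hP : ∀ x ∈ P, ∀ i, 0 ≤ x i ∧ x i ≤ 1) :
    LSPlus^[Fintype.card V] P = integerHull P := by
  refine Set.Subset.antisymm ?_ (integerHull_subset_LSPlus_iterate hc _)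
  simpa [integerHull] using LSPlus_iterate_subset_convexHull hP Finset.univ

/-- `sInf ∅ = 0`, so the bound needs some iterate to equal the integer hull; antitonicity then
excludes all indices up to `m`. -/
theorem lt_LSPlusRank [Fintype V] [Nonempty V] (hc : Convex ℝ P)
    (hP : ∀ x ∈ P, ∀ i, 0 ≤ x i ∧ x i ≤ 1) {m : ℕ} {y : V → ℝ} (hy : y ∈ LSPlus^[m] P)
    (hy' : y ∉ integerHull P) : m < LSPlusRank P := by
  by_contra! h
  have hmem : LSPlus^[LSPlusRank P] P = integerHull P :=
    Nat.sInf_mem (s := {m : ℕ | LSPlus^[m] P = integerHull P})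
      ⟨_, LSPlus_iterate_card_eq_integerHull hc hP⟩
  exact hy' (hmem ▸ LSPlus_iterate_antitone hc h hy)

end LSPlus

/-! ### Reindexing -/

theorem LSPlus_preimage_comp_subset {V V' : Type*} (e : V ≃ V') (P : Set (V → ℝ)) :
    LSPlus {x : V' → ℝ | x ∘ e ∈ P} ⊆ {x | x ∘ e ∈ LSPlus P} := by
  rintro x ⟨Y, ⟨hY, hYd, hYc⟩, h0, h1⟩
  refine ⟨Y.submatrix (Option.map e) (Option.map e), ⟨hY.submatrix _, ?_, fun i => ?_⟩,
    by simpa using h0, fun i => by simpa using h1 (e i)⟩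
  · ext o
    exact congrFun hYd (Option.map e o)
  · obtain ⟨⟨t, ht, y, hy, a0, a1⟩, ⟨s, hs, z, hz, b0, b1⟩⟩ := hYc (e i)
    exact ⟨⟨t, ht, y ∘ e, hy, a0, fun j => a1 (e j)⟩, ⟨s, hs, z ∘ e, hz, b0, fun j => b1 (e j)⟩⟩

theorem preimage_comp_preimage_comp_symm {V V' : Type*} (e : V ≃ V') (P : Set (V → ℝ)) :
    {x : V → ℝ | x ∘ e.symm ∈ {x : V' → ℝ | x ∘ e ∈ P}} = P := by
  ext x
  simp [Function.comp_assoc]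

theorem LSPlus_preimage_comp {V V' : Type*} (e : V ≃ V') (P : Set (V → ℝ)) :
    LSPlus {x : V' → ℝ | x ∘ e ∈ P} = {x | x ∘ e ∈ LSPlus P} := by
  refine (LSPlus_preimage_comp_subset e P).antisymm fun x hx => ?_
  have h := LSPlus_preimage_comp_subset e.symm {x : V' → ℝ | x ∘ e ∈ P}
  rw [preimage_comp_preimage_comp_symm] at h
  have := h hx
  simpa [Function.comp_assoc] using this

theorem LSPlus_iterate_preimage_comp {V V' : Type*} (e : V ≃ V') (P : Set (V → ℝ)) (m : ℕ) :
    LSPlus^[m] {x : V' → ℝ | x ∘ e ∈ P} = {x | x ∘ e ∈ LSPlus^[m] P} := by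
  induction m with
  | zero => rfl
  | succ m ih => rw [Function.iterate_succ_apply', ih, LSPlus_preimage_comp,
      Function.iterate_succ_apply']

theorem integerHull_preimage_comp {V V' : Type*} (e : V ≃ V') (P : Set (V → ℝ)) :
    integerHull {x : V' → ℝ | x ∘ e ∈ P} = {x | x ∘ e ∈ integerHull P} := by
  let L : (V → ℝ) ≃ₗ[ℝ] (V' → ℝ) := LinearEquiv.funCongrLeft ℝ ℝ e.symm
  have key : ∀ A : Set (V → ℝ), {x : V' → ℝ | x ∘ e ∈ A} = L '' A := by
    intro A
    ext x
    constructor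
    · intro hx
      exact ⟨x ∘ e, hx, by ext i; simp [L, LinearEquiv.funCongrLeft]⟩
    · rintro ⟨y, hy, rfl⟩
      have : (L y) ∘ e = y := by ext i; simp [L, LinearEquiv.funCongrLeft]
      simpa [this] using hy
  have hint : {x : V' → ℝ | x ∘ e ∈ P} ∩ {x | ∀ i, x i = 0 ∨ x i = 1} =
      {x | x ∘ e ∈ P ∩ {x | ∀ i, x i = 0 ∨ x i = 1}} := by
    ext x
    simp only [Set.mem_inter_iff, Set.mem_ofPred_eq, Function.comp_apply]
    exact and_congr_right fun _ => e.forall_congr_right.symm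
  unfold integerHull
  rw [hint, key, key]
  exact (L.toLinearMap.image_convexHull _).symm

theorem LSPlusRank_preimage_comp {V V' : Type*} (e : V ≃ V') (P : Set (V → ℝ)) :
    LSPlusRank {x : V' → ℝ | x ∘ e ∈ P} = LSPlusRank P := by
  unfold LSPlusRank
  congr 1
  ext m
  simp only [Set.mem_ofPred_eq, LSPlus_iterate_preimage_comp, integerHull_preimage_comp]
  constructor
  · intro h
    have := congrArg (fun A : Set (V' → ℝ) => {x : V → ℝ | x ∘ e.symm ∈ A}) h
    simpa [Function.comp_assoc] using this
  · intro h
    rw [h]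

namespace SimpleGraph

/-- Needed to pass from the vertex set `Fin k × Fin 4` to some `Fin n`. -/
theorem lsPlusRank_eq_of_iso {V V' : Type*} {G : SimpleGraph V} {G' : SimpleGraph V'}
    (e : G ≃g G') : G'.lsPlusRank = G.lsPlusRank := by
  unfold lsPlusRank
  rw [← LSPlusRank_preimage_comp e.toEquiv]
  congr 1
  ext x
  simp only [fracPolytope, Set.mem_ofPred_eq, Function.comp_apply]
  refine and_congr e.toEquiv.forall_congr_right.symm ?_
  rw [← e.toEquiv.forall_congr_right]
  refine forall_congr' fun i => ?_
  rw [← e.toEquiv.forall_congr_right]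
  exact forall_congr' fun j => by simp [e.map_adj_iff]

theorem IsVertexTransitive.of_iso {V V' : Type*} {G : SimpleGraph V} {G' : SimpleGraph V'}
    (h : G.IsVertexTransitive) (e : G ≃g G') : G'.IsVertexTransitive := by
  intro u v
  obtain ⟨φ, hφ⟩ := h (e.symm u) (e.symm v)
  exact ⟨(e.symm.trans φ).trans e, by simp [hφ]⟩

theorem convex_fracPolytope {V : Type*} (G : SimpleGraph V) : Convex ℝ G.fracPolytope := by
  rintro x ⟨hx, hxe⟩ y ⟨hy, hye⟩ a b ha hb hab
  refine ⟨fun i => ⟨?_, ?_⟩, fun i j hij => ?_⟩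
  · have := (hx i).1; have := (hy i).1
    simp only [Pi.add_apply, Pi.smul_apply, smul_eq_mul]; positivity
  · have := mul_le_mul_of_nonneg_left (hx i).2 ha
    have := mul_le_mul_of_nonneg_left (hy i).2 hb
    simp only [Pi.add_apply, Pi.smul_apply, smul_eq_mul]; linarith
  · have := mul_le_mul_of_nonneg_left (hxe i j hij) ha
    have := mul_le_mul_of_nonneg_left (hye i j hij) hb
    simp only [Pi.add_apply, Pi.smul_apply, smul_eq_mul]; linarith

end SimpleGraph

/-! ### Feasible directions of homogenized cones -/

/-- The direction `x` can be followed from `a` for a positive time without leaving `K`. -/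
def FeasDir {E : Type*} [AddCommGroup E] [Module ℝ E] (K : Set E) (a x : E) : Prop :=
  ∃ ε₀ > 0, ∀ ε : ℝ, 0 ≤ ε → ε ≤ ε₀ → a + ε • x ∈ K

section FeasDir

variable {W : Type*} {P : Set (W → ℝ)} {a x y : Option W → ℝ}

theorem FeasDir.base_mem (h : FeasDir (homogCone P) a x) : a ∈ homogCone P := by
  obtain ⟨ε₀, h0, h⟩ := h
  simpa using h 0 le_rfl h0.le

theorem feasDir_zero (h : a ∈ homogCone P) : FeasDir (homogCone P) a 0 :=
  ⟨1, one_pos, fun ε _ _ => by simpa using h⟩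

theorem FeasDir.add (hP : Convex ℝ P) (hx : FeasDir (homogCone P) a x)
    (hy : FeasDir (homogCone P) a y) : FeasDir (homogCone P) a (x + y) := by
  obtain ⟨ε₁, h1, hx⟩ := hx
  obtain ⟨ε₂, h2, hy⟩ := hy
  -- The target is the midpoint of `a + 2ε • x` and `a + 2ε • y`, hence the halved step length.
  refine ⟨min ε₁ ε₂ / 2, by positivity, fun ε h0 h => ?_⟩
  have := min_le_left ε₁ ε₂
  have := min_le_right ε₁ ε₂
  have ex := smul_mem_homogCone (hx (2 * ε) (by linarith) (by linarith)) (a := 1 / 2) (by norm_num)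
  have ey := smul_mem_homogCone (hy (2 * ε) (by linarith) (by linarith)) (a := 1 / 2) (by norm_num)
  convert add_mem_homogCone hP ex ey using 1
  module

theorem FeasDir.smul (hx : FeasDir (homogCone P) a x) {c : ℝ} (hc : 0 ≤ c) :
    FeasDir (homogCone P) a (c • x) := by
  obtain ⟨ε₁, h1, hx⟩ := hx
  refine ⟨ε₁ / (c + 1), by positivity, fun ε h0 h => ?_⟩
  rw [smul_smul]
  refine hx _ (by positivity) ?_
  rw [le_div_iff₀ (by positivity)] at h
  nlinarith

theorem FeasDir.sum (hP : Convex ℝ P) (ha : a ∈ homogCone P) {ι : Type*} (s : Finset ι)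
    {x : ι → Option W → ℝ} (hx : ∀ i ∈ s, FeasDir (homogCone P) a (x i)) :
    FeasDir (homogCone P) a (∑ i ∈ s, x i) := by
  classical
  induction s using Finset.induction_on with
  | empty => simpa using feasDir_zero ha
  | insert i s hi ih =>
    rw [Finset.sum_insert hi]
    exact (hx i (by simp)).add hP (ih fun j hj => hx j (by simp [hj]))

theorem feasDir_of_mem (hP : Convex ℝ P) (ha : a ∈ homogCone P) (hx : x ∈ homogCone P) :
    FeasDir (homogCone P) a x :=
  ⟨1, one_pos, fun _ h0 _ => add_mem_homogCone hP ha (smul_mem_homogCone hx h0)⟩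

theorem feasDir_neg_of_sub_mem (hP : Convex ℝ P) (ha : a ∈ homogCone P)
    (hx : a - x ∈ homogCone P) : FeasDir (homogCone P) a (-x) := by
  refine ⟨1, one_pos, fun ε h0 h1 => ?_⟩
  convert add_mem_homogCone hP (smul_mem_homogCone ha (sub_nonneg.2 h1))
    (smul_mem_homogCone hx h0) using 1
  module

theorem sum_mem_homogCone (hP : Convex ℝ P) (hne : P.Nonempty) {ι : Type*} (s : Finset ι)
    {x : ι → Option W → ℝ} (hx : ∀ i ∈ s, x i ∈ homogCone P) :
    ∑ i ∈ s, x i ∈ homogCone P := by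
  classical
  induction s using Finset.induction_on with
  | empty => simpa using zero_mem_homogCone hne
  | insert i s hi ih =>
    rw [Finset.sum_insert hi]
    exact add_mem_homogCone hP (hx i (by simp)) (ih fun j hj => hx j (by simp [hj]))

/-- Every generator is a summand of the base point, so it can be subtracted as well as added; the
feasible directions therefore contain the whole span. -/
theorem feasDir_of_mem_span (hP : Convex ℝ P) (hne : P.Nonempty) {ι : Type*} (s : Finset ι)
    {S : ι → Option W → ℝ} (hS : ∀ i ∈ s, S i ∈ homogCone P)
    (hx : x ∈ Submodule.span ℝ (S '' s)) : FeasDir (homogCone P) (∑ i ∈ s, S i) x := by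
  classical
  have ha := sum_mem_homogCone hP hne s hS
  suffices h : FeasDir (homogCone P) (∑ i ∈ s, S i) x ∧
      FeasDir (homogCone P) (∑ i ∈ s, S i) (-x) from h.1
  induction hx using Submodule.span_induction with
  | mem x hx =>
    obtain ⟨i, hi, rfl⟩ := hx
    refine ⟨feasDir_of_mem hP ha (hS i hi), feasDir_neg_of_sub_mem hP ha ?_⟩
    rw [← Finset.sum_erase_eq_sub hi]
    exact sum_mem_homogCone hP hne _ fun j hj => hS j (Finset.mem_of_mem_erase hj)
  | zero => simpa using feasDir_zero ha
  | add x y _ _ hx hy => exact ⟨hx.1.add hP hy.1, by rw [neg_add]; exact hx.2.add hP hy.2⟩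
  | smul c x _ hx =>
    rcases le_total 0 c with hc | hc
    · exact ⟨hx.1.smul hc, by rw [← smul_neg]; exact hx.2.smul hc⟩
    · refine ⟨?_, ?_⟩
      · have := hx.2.smul (neg_nonneg.2 hc)
        rwa [smul_neg, neg_smul, neg_neg] at this
      · have := hx.1.smul (neg_nonneg.2 hc)
        rwa [neg_smul] at this

end FeasDir

/-! ### Stretched cliques -/

/-- The polytope of a clique with vertex set `V` whose vertices outside `U` are stretched to paths
`(i, 0), (i, 1), (i, 2)`, with an edge from `(i, 0)` to `(j, 2)` whenever `r i j`. A vertex `i`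
that is not in `V` is fixed at the pattern `(0, 1, 0)`, an unstretched vertex of value `t` appears
as the pattern `(t, 1 - t, t)`, and the coordinates `(i, 3)` vanish. -/
structure IsStretchPoint {I : Type*} (r : I → I → Prop) (V U : Finset I) (x : I × Fin 4 → ℝ) :
    Prop where
  nonneg : ∀ w, 0 ≤ x w
  le_one : ∀ w, x w ≤ 1
  three : ∀ i, x (i, 3) = 0
  edge01 : ∀ i, x (i, 0) + x (i, 1) ≤ 1
  edge12 : ∀ i, x (i, 1) + x (i, 2) ≤ 1
  edge02 : ∀ i j, r i j → x (i, 0) + x (j, 2) ≤ 1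
  inactive : ∀ i ∉ V, x (i, 0) = 0 ∧ x (i, 2) = 0 ∧ x (i, 1) = 1
  unstretched : ∀ i ∈ U, x (i, 0) = x (i, 2) ∧ x (i, 0) + x (i, 1) = 1

/-- The set of all points satisfying `IsStretchPoint`. -/
def stretchPoly {I : Type*} (r : I → I → Prop) (V U : Finset I) : Set (I × Fin 4 → ℝ) :=
  {x | IsStretchPoint r V U x}

/-- The linear equations satisfied by the homogenized points of `stretchPoly r V U`. -/
structure InLinHull {I : Type*} (V U : Finset I) (x : Option (I × Fin 4) → ℝ) : Prop where
  three : ∀ i, x (some (i, 3)) = 0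
  inactive : ∀ i ∉ V, x (some (i, 0)) = 0 ∧ x (some (i, 2)) = 0 ∧ x (some (i, 1)) = x none
  unstretched : ∀ i ∈ U, x (some (i, 0)) = x (some (i, 2)) ∧
    x (some (i, 0)) + x (some (i, 1)) = x none

/-- Every stretched active vertex has an in-neighbour and an out-neighbour. -/
def ProperlyStretched {I : Type*} (r : I → I → Prop) (V U : Finset I) : Prop :=
  ∀ i ∈ V, i ∉ U → (∃ v ∈ V, r v i) ∧ ∃ v ∈ V, r i v

/-- The sum of the coordinates on the paths. -/
def pathSum {I : Type*} [Fintype I] (x : I × Fin 4 → ℝ) : ℝ :=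
  ∑ i, (x (i, 0) + x (i, 1) + x (i, 2))

/-- Some point of the `m`-th relaxation violates the inequality `pathSum x ≤ |I| + 1`. -/
def HasBeyondPoint {I : Type*} [Fintype I] (r : I → I → Prop) (m : ℕ) (V U : Finset I) : Prop :=
  ∃ y ∈ LSPlus^[m] (stretchPoly r V U), (Fintype.card I : ℝ) + 1 < pathSum y

/-- The homogenized violation of the inequality `pathSum x ≤ |I| + 1`. -/
def excess {I : Type*} [Fintype I] : (Option (I × Fin 4) → ℝ) →ₗ[ℝ] ℝ where
  toFun x := ∑ i, (x (some (i, 0)) + x (some (i, 1)) + x (some (i, 2)) - x none) - x none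
  map_add' x y := by
    simp only [Pi.add_apply, Finset.sum_add_distrib, Finset.sum_sub_distrib]
    ring
  map_smul' c x := by
    simp only [Pi.smul_apply, smul_eq_mul, RingHom.id_apply, mul_sub, Finset.mul_sum]
    congr 1
    exact Finset.sum_congr rfl fun i _ => by ring

/-- The homogenized incidence vector of the set of all middle vertices. -/
def midVec {I : Type*} : Option (I × Fin 4) → ℝ :=
  homogVec fun w => if w.2 = 1 then 1 else 0

/-- The unit vector of a vertex. -/
def unitVec {I : Type*} [DecidableEq I] (w : I × Fin 4) : Option (I × Fin 4) → ℝ :=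
  Pi.single (some w) 1

/-- The stable set with both ends of the path of `v`, the vertex `p` of the path of `i` (if
`i ≠ v`), and the middles of all other paths. -/
def tightSet {I : Type*} [DecidableEq I] (t : I × I × Fin 4) : I × Fin 4 → ℝ := fun w =>
  if w.1 = t.1 then (if w.2 = 0 ∨ w.2 = 2 then 1 else 0)
  else if w.1 = t.2.1 then (if w.2 = t.2.2 then 1 else 0)
  else (if w.2 = 1 then 1 else 0)

/-- `tightSet t` is a stable set of the clique on `V` stretched outside `U`. -/
def IsTightIndex {I : Type*} (r : I → I → Prop) (V U : Finset I) (t : I × I × Fin 4) : Prop :=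
  t.1 ∈ V ∧ (t.2.2 = 1 ∨ (t.2.1 ∈ V ∧ t.2.1 ∉ U ∧
    ((t.2.2 = 0 ∧ r t.1 t.2.1) ∨ (t.2.2 = 2 ∧ r t.2.1 t.1))))

open Classical in
/-- The indices of the tight stable sets. -/
noncomputable def tightIndices {I : Type*} [Fintype I] (r : I → I → Prop) (V U : Finset I) :
    Finset (I × I × Fin 4) :=
  Finset.univ.filter (IsTightIndex r V U)

/-! ### Tight stable sets and the space they span -/

section Stretch

variable {I : Type*} {r : I → I → Prop} {V U V₀ U₀ : Finset I}

theorem convex_stretchPoly : Convex ℝ (stretchPoly r V U) := by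
  intro x hx y hy a b ha hb hab
  constructor <;> intros <;> simp only [Pi.add_apply, Pi.smul_apply, smul_eq_mul]
  · exact add_nonneg (mul_nonneg ha (hx.nonneg _)) (mul_nonneg hb (hy.nonneg _))
  · nlinarith [hx.le_one ‹_›, hy.le_one ‹_›]
  · simp [hx.three, hy.three]
  · nlinarith [hx.edge01 ‹_›, hy.edge01 ‹_›]
  · nlinarith [hx.edge12 ‹_›, hy.edge12 ‹_›]
  · nlinarith [hx.edge02 _ _ ‹_›, hy.edge02 _ _ ‹_›]
  · obtain ⟨h1, h2, h3⟩ := hx.inactive _ ‹_›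
    obtain ⟨h1', h2', h3'⟩ := hy.inactive _ ‹_›
    simp [h1, h2, h3, h1', h2', h3', hab]
  · obtain ⟨h1, h2⟩ := hx.unstretched _ ‹_›
    obtain ⟨h1', h2'⟩ := hy.unstretched _ ‹_›
    exact ⟨by rw [h1, h1'], by linear_combination a * h2 + b * h2' + hab⟩

theorem stretchPoly_mono (hV : V₀ ⊆ V) (hU : ∀ u ∈ U, u ∈ V₀ → u ∈ U₀) :
    stretchPoly r V₀ U₀ ⊆ stretchPoly r V U := by
  intro x hx
  refine ⟨hx.nonneg, hx.le_one, hx.three, hx.edge01, hx.edge12, hx.edge02,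
    fun i hi => hx.inactive i fun h => hi (hV h), fun i hi => ?_⟩
  by_cases h : i ∈ V₀
  · exact hx.unstretched i (hU i hi h)
  · obtain ⟨h1, h2, h3⟩ := hx.inactive i h
    simp [h1, h2, h3]

theorem IsStretchPoint.inLinHull {x : I × Fin 4 → ℝ} (hx : IsStretchPoint r V U x) :
    InLinHull V U (homogVec x) :=
  ⟨hx.three, hx.inactive, hx.unstretched⟩

variable [DecidableEq I]

theorem tightSet_zero_or_one (t : I × I × Fin 4) (w : I × Fin 4) :
    tightSet t w = 0 ∨ tightSet t w = 1 := by
  unfold tightSet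
  split_ifs <;> simp

theorem IsTightIndex.isStretchPoint (hr : ∀ i j, r i j → ¬ r j i)
    {t : I × I × Fin 4} (ht : IsTightIndex r V U t) : IsStretchPoint r V U (tightSet t) := by
  obtain ⟨v, i, p⟩ := t
  obtain ⟨hv, hp⟩ := ht
  have hirr : ∀ i, ¬ r i i := fun i h => hr i i h h
  simp only at hv hp
  refine ⟨fun w => ?_, fun w => ?_, fun j => ?_, fun j => ?_, fun j => ?_, fun j l hjl => ?_,
    fun j hj => ?_, fun j hj => ?_⟩
  · rcases tightSet_zero_or_one (v, i, p) w with h | h <;> rw [h]; norm_num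
  · rcases tightSet_zero_or_one (v, i, p) w with h | h <;> rw [h]; norm_num
  · rcases hp with rfl | ⟨-, -, ⟨rfl, -⟩ | ⟨rfl, -⟩⟩ <;> simp [tightSet]
  · rcases hp with rfl | ⟨-, -, ⟨rfl, -⟩ | ⟨rfl, -⟩⟩ <;> simp only [tightSet] <;> split_ifs <;>
      simp_all
  · rcases hp with rfl | ⟨-, -, ⟨rfl, -⟩ | ⟨rfl, -⟩⟩ <;> simp only [tightSet] <;> split_ifs <;>
      simp_all
  · rcases hp with rfl | ⟨-, -, ⟨rfl, h⟩ | ⟨rfl, h⟩⟩ <;> simp only [tightSet] <;> split_ifs <;>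
      simp_all
  · rcases hp with rfl | ⟨hi, -, ⟨rfl, h⟩ | ⟨rfl, h⟩⟩ <;> simp only [tightSet] <;>
      have hjv : j ≠ v := (fun h => hj (h ▸ hv)) <;> simp [hjv] <;>
      have hji : j ≠ i := (fun h => hj (h ▸ hi)) <;> simp [hji]
  · rcases hp with rfl | ⟨hi, hiU, ⟨rfl, h⟩ | ⟨rfl, h⟩⟩
    · by_cases hjv : j = v <;> simp [tightSet, hjv]
    all_goals
      have hji : j ≠ i := (fun h => hiU (h ▸ hj))
      by_cases hjv : j = v <;> simp [tightSet, hjv, hji]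

theorem homogVec_tightSet_of_ne {v i : I} (h : i ≠ v) (p : Fin 4) :
    homogVec (tightSet (v, i, p)) =
      homogVec (tightSet (v, v, 1)) + unitVec (i, p) - unitVec (i, 1) := by
  ext o
  rcases o with _ | ⟨j, q⟩
  · simp [unitVec]
  · by_cases hjv : j = v
    · subst hjv
      simp [tightSet, unitVec, h.symm]
    · by_cases hji : j = i
      · subst hji
        simp [tightSet, unitVec, Pi.single_apply, hjv]
      · simp [tightSet, unitVec, hjv, hji]

theorem homogVec_tightSet_core (v : I) :
    homogVec (tightSet (v, v, 1)) =
      midVec + unitVec (v, 0) + unitVec (v, 2) - unitVec (v, 1) := by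
  ext o
  rcases o with _ | ⟨j, q⟩
  · simp [unitVec, midVec]
  · by_cases hjv : j = v
    · subst hjv
      fin_cases q <;> simp [tightSet, unitVec, midVec]
    · simp [tightSet, unitVec, midVec, hjv]

variable [Fintype I]

omit [DecidableEq I] in
theorem excess_homogVec (x : I × Fin 4 → ℝ) :
    excess (homogVec x) = pathSum x - (Fintype.card I + 1) := by
  simp [excess, pathSum, Finset.sum_sub_distrib]
  ring

omit [DecidableEq I] in
theorem excess_midVec : excess (midVec : Option (I × Fin 4) → ℝ) = -1 := by
  simp [excess, midVec]

theorem excess_unitVec (i : I) {p : Fin 4} (hp : p ≠ 3) : excess (unitVec (i, p)) = 1 := by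
  have hp : p = 0 ∨ p = 1 ∨ p = 2 := by
    fin_cases p <;> simp_all
  rcases hp with rfl | rfl | rfl <;> simp [excess, unitVec, Pi.single_apply]

omit [DecidableEq I] in
theorem mem_tightIndices {t : I × I × Fin 4} :
    t ∈ tightIndices r V U ↔ IsTightIndex r V U t := by
  simp [tightIndices]

/-- The path of `t.1` carries two chosen vertices and every other path exactly one. -/
theorem IsTightIndex.excess_eq_zero (hr : ∀ i, ¬ r i i)
    {t : I × I × Fin 4} (ht : IsTightIndex r V U t) : excess (homogVec (tightSet t)) = 0 := by
  obtain ⟨v, i, p⟩ := t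
  have hcore : excess (homogVec (tightSet (v, v, 1))) = 0 := by
    rw [homogVec_tightSet_core, map_sub, map_add, map_add, excess_midVec,
      excess_unitVec _ (by decide), excess_unitVec _ (by decide), excess_unitVec _ (by decide)]
    norm_num
  obtain ⟨hv, hp⟩ := ht
  simp only at hv hp
  by_cases h : i = v
  · subst h
    rcases hp with rfl | ⟨-, -, ⟨-, h⟩ | ⟨-, h⟩⟩
    · exact hcore
    · exact (hr _ h).elim
    · exact (hr _ h).elim
  · rw [homogVec_tightSet_of_ne h, map_sub, map_add, hcore, excess_unitVec i (p := 1) (by decide),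
      excess_unitVec]
    · norm_num
    · rcases hp with rfl | ⟨-, -, ⟨rfl, -⟩ | ⟨rfl, -⟩⟩ <;> decide

omit [DecidableEq I] in
theorem core_mem_tightIndices {v : I} (hv : v ∈ V) (i : I) : (v, i, 1) ∈ tightIndices r V U :=
  mem_tightIndices.2 ⟨hv, Or.inl rfl⟩

/-- The span of the homogenized tight stable sets. -/
def tightSpan (r : I → I → Prop) (V U : Finset I) : Submodule ℝ (Option (I × Fin 4) → ℝ) :=
  Submodule.span ℝ ((fun t => homogVec (tightSet t)) '' (tightIndices r V U : Set (I × I × Fin 4)))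

theorem tightSet_mem_tightSpan {t : I × I × Fin 4} (ht : IsTightIndex r V U t) :
    homogVec (tightSet t) ∈ tightSpan r V U :=
  Submodule.subset_span ⟨t, mem_tightIndices.2 ht, rfl⟩

/-- An in-neighbour `v` of `i` allows `(i, 0)` to replace `(i, 1)` in the tight set with both ends
of `v`; an out-neighbour does the same for `(i, 2)`. The difference of the two tight sets is the
vector in question. -/
theorem ProperlyStretched.sub_mem_tightSpan (hp : ProperlyStretched r V U) (hr : ∀ i, ¬ r i i)
    {i : I} (hi : i ∈ V) (hiU : i ∉ U) {p : Fin 4} (hp2 : p = 0 ∨ p = 2) :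
    unitVec (i, p) - unitVec (i, 1) ∈ tightSpan r V U := by
  have key : ∀ v ∈ V, IsTightIndex r V U (v, i, p) → i ≠ v →
      unitVec (i, p) - unitVec (i, 1) ∈ tightSpan r V U := by
    intro v hv ht hne
    have := Submodule.sub_mem _ (tightSet_mem_tightSpan ht)
      (tightSet_mem_tightSpan (r := r) (U := U) (t := (v, v, 1)) ⟨hv, Or.inl rfl⟩)
    rw [homogVec_tightSet_of_ne hne] at this
    convert this using 1
    abel
  obtain ⟨⟨v, hv, h⟩, ⟨v', hv', h'⟩⟩ := hp i hi hiU
  rcases hp2 with rfl | rfl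
  · exact key v hv ⟨hv, Or.inr ⟨hi, hiU, Or.inl ⟨rfl, h⟩⟩⟩ fun e => hr v (e ▸ h)
  · exact key v' hv' ⟨hv', Or.inr ⟨hi, hiU, Or.inr ⟨rfl, h'⟩⟩⟩ fun e => hr v' (e ▸ h')

theorem ProperlyStretched.unitVec_add_midVec_mem (hp : ProperlyStretched r V U)
    (hr : ∀ i, ¬ r i i) {i : I} (hi : i ∈ V) (hiU : i ∉ U) {p : Fin 4} (hp3 : p ≠ 3) :
    unitVec (i, p) + midVec ∈ tightSpan r V U := by
  have h0 := hp.sub_mem_tightSpan hr hi hiU (p := 0) (Or.inl rfl)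
  have h2 := hp.sub_mem_tightSpan hr hi hiU (p := 2) (Or.inr rfl)
  have hc := tightSet_mem_tightSpan (r := r) (U := U) (t := (i, i, 1)) ⟨hi, Or.inl rfl⟩
  rw [homogVec_tightSet_core] at hc
  have h1 : unitVec (i, 1) + midVec ∈ tightSpan r V U := by
    convert Submodule.sub_mem _ (Submodule.sub_mem _ hc h0) h2 using 1
    abel
  have hp : p = 0 ∨ p = 1 ∨ p = 2 := by
    fin_cases p <;> simp_all
  rcases hp with rfl | rfl | rfl
  · convert Submodule.add_mem _ h0 h1 using 1
    abel
  · exact h1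
  · convert Submodule.add_mem _ h2 h1 using 1
    abel

theorem InLinHull.eq_sum {x : Option (I × Fin 4) → ℝ} (hx : InLinHull V U x) :
    x + excess x • midVec = ∑ i, (x (some (i, 0)) • (unitVec (i, 0) + midVec)
      + (x (some (i, 1)) - x none) • (unitVec (i, 1) + midVec)
      + x (some (i, 2)) • (unitVec (i, 2) + midVec)) := by
  ext o
  rcases o with _ | ⟨j, q⟩
  · simp only [Pi.add_apply, Pi.smul_apply, smul_eq_mul, Finset.sum_apply, unitVec, midVec, excess,
      LinearMap.coe_mk, AddHom.coe_mk, homogVec_none]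
    simp only [Pi.single_apply, reduceCtorEq, if_false]
    rw [mul_one, add_sub_cancel]
    exact Finset.sum_congr rfl fun i _ => by ring
  · simp only [Pi.add_apply, Pi.smul_apply, smul_eq_mul, Finset.sum_apply, unitVec, midVec, excess,
      LinearMap.coe_mk, AddHom.coe_mk, homogVec_some, mul_add, Finset.sum_add_distrib,
      Pi.single_apply, Option.some.injEq, Prod.mk.injEq]
    have h3 := hx.three j
    fin_cases q <;> simp [Finset.sum_add_distrib, Finset.sum_sub_distrib, h3]
    ring

/-- Modulo the tight sets, the linear hull is spanned by `midVec` alone, which has excess `-1`. In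
the expansion `InLinHull.eq_sum`, a stretched path contributes three vectors of the span, an
unstretched one a multiple of its core set, and an inactive one nothing. -/
theorem ProperlyStretched.add_excess_smul_mem (hp : ProperlyStretched r V U)
    (hr : ∀ i, ¬ r i i) {x : Option (I × Fin 4) → ℝ} (hx : InLinHull V U x) :
    x + excess x • midVec ∈ tightSpan r V U := by
  rw [hx.eq_sum]
  refine Submodule.sum_mem _ fun i _ => ?_
  by_cases hi : i ∈ V
  · by_cases hiU : i ∈ U
    · obtain ⟨h1, h2⟩ := hx.unstretched i hiU
      have h3 : x (some (i, 1)) - x none = - x (some (i, 2)) := by linarith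
      have hc := tightSet_mem_tightSpan (r := r) (U := U) (t := (i, i, 1)) ⟨hi, Or.inl rfl⟩
      rw [homogVec_tightSet_core] at hc
      rw [h1, h3]
      convert Submodule.smul_mem _ (x (some (i, 2))) hc using 1
      module
    · exact Submodule.add_mem _ (Submodule.add_mem _
        (Submodule.smul_mem _ _ (hp.unitVec_add_midVec_mem hr hi hiU (by decide)))
        (Submodule.smul_mem _ _ (hp.unitVec_add_midVec_mem hr hi hiU (by decide))))
        (Submodule.smul_mem _ _ (hp.unitVec_add_midVec_mem hr hi hiU (by decide)))
  · obtain ⟨h1, h2, h3⟩ := hx.inactive i hi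
    simp [h1, h2, h3]

omit [DecidableEq I] in
theorem tightIndices_mono (hV : V₀ ⊆ V) (hU : ∀ u ∈ U, u ∈ V₀ → u ∈ U₀) :
    tightIndices r V₀ U₀ ⊆ tightIndices r V U := by
  intro t ht
  rw [mem_tightIndices] at ht ⊢
  refine ⟨hV ht.1, ht.2.imp_right fun h => ⟨hV h.1, fun hu => h.2.1 (hU _ hu h.1), h.2.2⟩⟩

-- Tight sets of a clique avoiding `i` all contain `(i, 1)` and no other vertex of the path of `i`.
-- This is what places them in the required column sums of `tightMatrix`.
omit [Fintype I] in
theorem IsTightIndex.apply_of_notMem {t : I × I × Fin 4} (ht : IsTightIndex r V U t) {i : I}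
    (hi : i ∉ V) (p : Fin 4) : tightSet t (i, p) = if p = 1 then 1 else 0 := by
  obtain ⟨v, l, q⟩ := t
  obtain ⟨hv, hq⟩ := ht
  have hiv : i ≠ v := fun h => hi (h ▸ hv)
  simp only at hq
  rcases hq with rfl | ⟨hl, -⟩
  · simp [tightSet, hiv]
  · have hil : i ≠ l := fun h => hi (h ▸ hl)
    simp [tightSet, hiv, hil]

end Stretch

/-! ### The lifting step -/

section Certificate

variable {I : Type*} [Fintype I] [DecidableEq I] {r : I → I → Prop} {V U V₀ U₀ : Finset I}

/-- The vector `midVec` without the middles of the paths in `D`. -/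
def restVec (D : Finset I) : Option (I × Fin 4) → ℝ :=
  midVec - ∑ i ∈ D, unitVec (i, 1)

/-- The sum of the rank one matrices of the tight stable sets. -/
noncomputable def tightMatrix (r : I → I → Prop) (V U : Finset I) :
    Matrix (Option (I × Fin 4)) (Option (I × Fin 4)) ℝ :=
  ∑ t ∈ tightIndices r V U, Matrix.vecMulVec (homogVec (tightSet t)) (homogVec (tightSet t))

/-- The perturbation of `tightMatrix`. -/
noncomputable def perturbMatrix (D : Finset I) (β : ℝ) :
    Matrix (Option (I × Fin 4)) (Option (I × Fin 4)) ℝ :=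
  Matrix.vecMulVec (restVec D) (restVec D) + β • ∑ i ∈ D,
    (Matrix.vecMulVec (restVec D) (unitVec (i, 1)) + Matrix.vecMulVec (unitVec (i, 1)) (restVec D)
      + Matrix.vecMulVec (unitVec (i, 1)) (unitVec (i, 1)))

omit [Fintype I] in
theorem restVec_none (D : Finset I) : restVec D none = 1 := by
  simp [restVec, midVec, unitVec]

omit [Fintype I] in
theorem restVec_some (D : Finset I) (i : I) (p : Fin 4) :
    restVec D (some (i, p)) = if p = 1 ∧ i ∉ D then 1 else 0 := by
  by_cases hp : p = 1
  · subst hp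
    by_cases hi : i ∈ D <;>
      simp [restVec, midVec, unitVec, Finset.sum_apply, Pi.single_apply, hi]
  · simp [restVec, midVec, unitVec, Finset.sum_apply, hp]

-- In terms of `m` and the `δ i`, with `d = D.card`, the left side is `(1/2 - d²) m² + 2 d m σ + (1
-- - 2β) σ² + β Q`, where `σ = ∑ δ i` and `Q = ∑ δ i ^ 2`. The coefficient of `m²` is negative, so
-- `m` can be absorbed and only `Q` remains.
omit [Fintype I] [DecidableEq I] in
theorem quadratic_bound {D : Finset I} {β : ℝ} (hβ : β * D.card = D.card + 1 / 2) (hβ1 : 1 ≤ β)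
    (hβ2 : β ≤ 2) (m : ℝ) (l δ : I → ℝ) (hl : ∀ i ∈ D, δ i = m + l i) :
    (m - ∑ i ∈ D, l i) ^ 2 + β * ∑ i ∈ D, (2 * (m - ∑ j ∈ D, l j) * l i + l i ^ 2) ≤
      (2 * D.card + 2) * ∑ i ∈ D, δ i ^ 2 := by
  set d : ℝ := (D.card : ℝ) with hd
  have hd1 : 1 / 2 ≤ d := by nlinarith
  set σ := ∑ i ∈ D, δ i with hσ
  set Q := ∑ i ∈ D, δ i ^ 2 with hQ
  have hQ0 : 0 ≤ Q := Finset.sum_nonneg fun i _ => sq_nonneg _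
  have h1 : ∑ i ∈ D, l i = σ - d * m := by
    rw [hσ, Finset.sum_congr rfl hl, Finset.sum_add_distrib, Finset.sum_const, nsmul_eq_mul]
    ring
  have h2 : ∑ i ∈ D, l i ^ 2 = Q - 2 * m * σ + d * m ^ 2 := by
    have : ∀ i ∈ D, l i ^ 2 = δ i ^ 2 - 2 * m * δ i + m ^ 2 := fun i hi => by rw [hl i hi]; ring
    rw [Finset.sum_congr rfl this, Finset.sum_add_distrib, Finset.sum_sub_distrib,
      ← Finset.mul_sum, Finset.sum_const, nsmul_eq_mul]
  have hσQ : σ ^ 2 ≤ d * Q := sq_sum_le_card_mul_sum_sq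
  rw [Finset.sum_add_distrib, ← Finset.mul_sum, h1, h2]
  have hd2 : (1 : ℝ) ≤ d ^ 2 := by
    have : (1 : ℝ) ≤ d := by
      rw [hd]
      have : 0 < D.card := by
        rw [Nat.pos_iff_ne_zero]
        intro h0
        rw [hd, h0] at hd1
        norm_num at hd1
      exact_mod_cast this
    nlinarith
  have key : (m - (σ - d * m)) ^ 2 + β * (2 * (m - (σ - d * m)) * (σ - d * m)
      + (Q - 2 * m * σ + d * m ^ 2)) =
      (1 / 2 - d ^ 2) * m ^ 2 + 2 * d * m * σ + (1 - 2 * β) * σ ^ 2 + β * Q := by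
    linear_combination (-2 * d * m ^ 2 - m ^ 2 + 4 * m * σ) * hβ
  rw [key]
  -- From `2 d m σ ≤ d² m² / 2 + 2 σ²` the `m²` term becomes nonpositive, and `σ² ≤ d Q` with `1 ≤ β
  -- ≤ 2` bounds the rest by `(d + 2) Q`.
  nlinarith [sq_nonneg (d * m - 2 * σ), sq_nonneg σ, sq_nonneg m,
    mul_nonneg (sub_nonneg.2 hβ1) (sq_nonneg σ), mul_nonneg (sub_nonneg.2 hβ2) hQ0,
    mul_nonneg (sub_nonneg.2 hd2) (sq_nonneg m)]

theorem dotProduct_vecMulVec_mulVec {n : Type*} [Fintype n] (a b x : n → ℝ) :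
    x ⬝ᵥ (Matrix.vecMulVec a b).mulVec x = (x ⬝ᵥ a) * (x ⬝ᵥ b) := by
  rw [Matrix.vecMulVec_mulVec, dotProduct_comm b x]
  simp [dotProduct_smul, mul_comm]

theorem dotProduct_tightMatrix (x : Option (I × Fin 4) → ℝ) :
    x ⬝ᵥ (tightMatrix r V U).mulVec x =
      ∑ t ∈ tightIndices r V U, (x ⬝ᵥ homogVec (tightSet t)) ^ 2 := by
  rw [tightMatrix, Matrix.sum_mulVec, dotProduct_sum]
  exact Finset.sum_congr rfl fun t _ => by rw [dotProduct_vecMulVec_mulVec, sq]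

theorem dotProduct_perturbMatrix (D : Finset I) (β : ℝ) (x : Option (I × Fin 4) → ℝ) :
    x ⬝ᵥ (perturbMatrix D β).mulVec x = (x ⬝ᵥ restVec D) ^ 2 + β * ∑ i ∈ D,
      (2 * (x ⬝ᵥ restVec D) * (x ⬝ᵥ unitVec (i, 1)) + (x ⬝ᵥ unitVec (i, 1)) ^ 2) := by
  rw [perturbMatrix, Matrix.add_mulVec, dotProduct_add, dotProduct_vecMulVec_mulVec,
    Matrix.smul_mulVec, dotProduct_smul, Matrix.sum_mulVec, dotProduct_sum, smul_eq_mul, sq]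
  congr 2
  refine Finset.sum_congr rfl fun i _ => ?_
  rw [Matrix.add_mulVec, Matrix.add_mulVec, dotProduct_add, dotProduct_add,
    dotProduct_vecMulVec_mulVec, dotProduct_vecMulVec_mulVec, dotProduct_vecMulVec_mulVec]
  ring

/-- `midVec + unitVec (i, 1)` is a signed sum of five homogenized tight sets: three cores minus two
sets moved to an end of the path of `i`. Each term has square at most the full sum, which gives the
factor `5² = 25`. -/
theorem sq_dotProduct_le (hr : ∀ i, ¬ r i i) (hp : ProperlyStretched r V U)
    {i : I} (hi : i ∈ V) (hiU : i ∉ U) (x : Option (I × Fin 4) → ℝ) :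
    (x ⬝ᵥ midVec + x ⬝ᵥ unitVec (i, 1)) ^ 2 ≤ 25 *
      ∑ t ∈ tightIndices r V U, (x ⬝ᵥ homogVec (tightSet t)) ^ 2 := by
  obtain ⟨⟨v, hv, h⟩, ⟨w, hw, h'⟩⟩ := hp i hi hiU
  have hvi : i ≠ v := fun e => hr v (e ▸ h)
  have hwi : i ≠ w := fun e => hr w (e ▸ h')
  have hle : ∀ t, IsTightIndex r V U t → (x ⬝ᵥ homogVec (tightSet t)) ^ 2 ≤
      ∑ t ∈ tightIndices r V U, (x ⬝ᵥ homogVec (tightSet t)) ^ 2 := fun t ht =>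
    Finset.single_le_sum (f := fun t => (x ⬝ᵥ homogVec (tightSet t)) ^ 2)
      (fun t _ => sq_nonneg _) (mem_tightIndices.2 ht)
  have a1 := hle (i, i, 1) ⟨hi, Or.inl rfl⟩
  have a2 := hle (v, v, 1) ⟨hv, Or.inl rfl⟩
  have a3 := hle (w, w, 1) ⟨hw, Or.inl rfl⟩
  have a4 := hle (v, i, 0) ⟨hv, Or.inr ⟨hi, hiU, Or.inl ⟨rfl, h⟩⟩⟩
  have a5 := hle (w, i, 2) ⟨hw, Or.inr ⟨hi, hiU, Or.inr ⟨rfl, h'⟩⟩⟩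
  have e4 := congrArg (x ⬝ᵥ ·) (homogVec_tightSet_of_ne hvi 0)
  have e5 := congrArg (x ⬝ᵥ ·) (homogVec_tightSet_of_ne hwi 2)
  have e1 := congrArg (x ⬝ᵥ ·) (homogVec_tightSet_core i)
  simp only [dotProduct_add, dotProduct_sub] at e1 e4 e5
  set s := ∑ t ∈ tightIndices r V U, (x ⬝ᵥ homogVec (tightSet t)) ^ 2
  set b1 := x ⬝ᵥ homogVec (tightSet (i, i, 1))
  set b2 := x ⬝ᵥ homogVec (tightSet (v, v, 1))
  set b3 := x ⬝ᵥ homogVec (tightSet (w, w, 1))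
  set b4 := x ⬝ᵥ homogVec (tightSet (v, i, 0))
  set b5 := x ⬝ᵥ homogVec (tightSet (w, i, 2))
  have : x ⬝ᵥ midVec + x ⬝ᵥ unitVec (i, 1) = b1 + b2 + b3 - b4 - b5 := by linarith
  rw [this]
  nlinarith [sq_nonneg (b1 - b2), sq_nonneg (b1 - b3), sq_nonneg (b1 + b4), sq_nonneg (b1 + b5),
    sq_nonneg (b2 - b3), sq_nonneg (b2 + b4), sq_nonneg (b2 + b5), sq_nonneg (b3 + b4),
    sq_nonneg (b3 + b5), sq_nonneg (b4 - b5)]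

theorem posSemidef_tightMatrix_sub (hr : ∀ i, ¬ r i i) (hp : ProperlyStretched r V U)
    {β : ℝ} (hβ : β * (V \ U).card = (V \ U).card + 1 / 2) (hβ1 : 1 ≤ β) (hβ2 : β ≤ 2) :
    ∃ ε₀ > 0, ∀ ε : ℝ, 0 ≤ ε → ε ≤ ε₀ →
      (tightMatrix r V U - ε • perturbMatrix (V \ U) β).PosSemidef := by
  set D := V \ U with hD
  -- The product combines the constants of `quadratic_bound` and `sq_dotProduct_le`; the final `1`
  -- keeps `C` positive.
  set C : ℝ := (2 * D.card + 2) * (D.card * 25) + 1 with hC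
  have hC0 : 0 < C := by positivity
  refine ⟨1 / C, by positivity, fun ε h0 h1 => ?_⟩
  rw [Matrix.posSemidef_iff_dotProduct_mulVec]
  refine ⟨?_, fun x => ?_⟩
  · ext o o'
    simp only [tightMatrix, perturbMatrix, Matrix.conjTranspose_apply, Matrix.sub_apply,
      Matrix.smul_apply, Matrix.sum_apply, Matrix.add_apply, Matrix.vecMulVec_apply, smul_eq_mul,
      star_trivial]
    congr 1
    · exact Finset.sum_congr rfl fun t _ => mul_comm _ _
    · congr 2
      · exact mul_comm _ _
      · congr 1
        exact Finset.sum_congr rfl fun i _ => by ring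
  · rw [star_trivial, Matrix.sub_mulVec, dotProduct_sub, Matrix.smul_mulVec, dotProduct_smul,
      smul_eq_mul, dotProduct_tightMatrix, dotProduct_perturbMatrix]
    set q := ∑ t ∈ tightIndices r V U, (x ⬝ᵥ homogVec (tightSet t)) ^ 2
    have hq : 0 ≤ q := Finset.sum_nonneg fun t _ => sq_nonneg _
    have hrest : x ⬝ᵥ restVec D = x ⬝ᵥ midVec - ∑ i ∈ D, x ⬝ᵥ unitVec (i, 1) := by
      rw [restVec, dotProduct_sub, dotProduct_sum]
    have hb := quadratic_bound hβ hβ1 hβ2 (x ⬝ᵥ midVec) (fun i => x ⬝ᵥ unitVec (i, 1))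
      (fun i => x ⬝ᵥ midVec + x ⬝ᵥ unitVec (i, 1)) fun _ _ => rfl
    have hs : ∑ i ∈ D, (x ⬝ᵥ midVec + x ⬝ᵥ unitVec (i, 1)) ^ 2 ≤ D.card * (25 * q) := by
      rw [← nsmul_eq_mul]
      refine Finset.sum_le_card_nsmul _ _ _ fun i hi => ?_
      rw [hD, Finset.mem_sdiff] at hi
      exact sq_dotProduct_le hr hp hi.1 hi.2 x
    rw [← hrest] at hb
    have hbq := hb.trans (mul_le_mul_of_nonneg_left hs (by positivity))
    have hCq : (2 * (D.card : ℝ) + 2) * (D.card * (25 * q)) ≤ C * q := by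
      rw [hC]; nlinarith
    have h2 := mul_le_mul_of_nonneg_left (hbq.trans hCq) h0
    have h3 : ε * (C * q) ≤ q := by
      have : ε * C ≤ 1 := by rwa [le_div_iff₀ hC0] at h1
      nlinarith
    linarith

end Certificate

/-! ### Columns of the perturbed matrix and their feasible directions -/

section Step

variable {I : Type*} [Fintype I] [DecidableEq I] {r : I → I → Prop} {V U V₀ U₀ : Finset I}

omit [Fintype I] in
theorem sum_unitVec_apply (D : Finset I) (i : I) (p : Fin 4) :
    (∑ j ∈ D, unitVec (j, 1)) (some (i, p)) = if p = 1 ∧ i ∈ D then (1 : ℝ) else 0 := by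
  by_cases hp : p = 1
  · subst hp
    simp [unitVec, Finset.sum_apply, Pi.single_apply]
  · simp [unitVec, Finset.sum_apply, hp]

omit [Fintype I] in
theorem perturbMatrix_col (D : Finset I) (β : ℝ) (o : Option (I × Fin 4)) :
    (perturbMatrix D β).col o = restVec D o • (restVec D + β • ∑ j ∈ D, unitVec (j, 1)) +
      β • ∑ j ∈ D, unitVec (j, 1) o • (restVec D + unitVec (j, 1)) := by
  ext o'
  simp only [perturbMatrix, Matrix.col_apply, Matrix.add_apply, Matrix.smul_apply,
    Matrix.sum_apply, Matrix.vecMulVec_apply, Pi.add_apply, Pi.smul_apply, smul_eq_mul,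
    Finset.sum_apply]
  have h : ∀ f g : I → ℝ, restVec D o * (restVec D o' + β * ∑ j ∈ D, f j) + β * ∑ j ∈ D, g j =
      restVec D o' * restVec D o + β * ∑ j ∈ D, (restVec D o * f j + g j) := fun f g => by
    rw [Finset.sum_add_distrib, ← Finset.mul_sum]
    ring
  rw [h]
  congr 2
  exact Finset.sum_congr rfl fun j _ => by ring

omit [Fintype I] in
theorem perturbMatrix_col_none (D : Finset I) (β : ℝ) :
    (perturbMatrix D β).col none = restVec D + β • ∑ j ∈ D, unitVec (j, 1) := by
  rw [perturbMatrix_col, restVec_none]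
  simp [unitVec]

omit [Fintype I] in
theorem perturbMatrix_col_of_ne {D : Finset I} {β : ℝ} {i : I} {p : Fin 4} (hp : p ≠ 1) :
    (perturbMatrix D β).col (some (i, p)) = 0 := by
  rw [perturbMatrix_col, restVec_some]
  simp [unitVec, hp]

omit [Fintype I] in
theorem perturbMatrix_col_of_notMem {D : Finset I} {β : ℝ} {i : I} (hi : i ∉ D) :
    (perturbMatrix D β).col (some (i, 1)) = (perturbMatrix D β).col none := by
  have h : ∑ j ∈ D, unitVec (j, 1) (some (i, 1)) • (restVec D + unitVec (j, 1)) = 0 :=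
    Finset.sum_eq_zero fun j hj => by
      have : i ≠ j := fun h => hi (h ▸ hj)
      simp [unitVec, this]
  rw [perturbMatrix_col_none, perturbMatrix_col, restVec_some, h]
  simp [hi]

omit [Fintype I] in
theorem perturbMatrix_col_of_mem {D : Finset I} {β : ℝ} {i : I} (hi : i ∈ D) :
    (perturbMatrix D β).col (some (i, 1)) = β • (restVec D + unitVec (i, 1)) := by
  have h : ∑ j ∈ D, unitVec (j, 1) (some (i, 1)) • (restVec D + unitVec (j, 1)) =
      restVec D + unitVec (i, 1) := by
    rw [Finset.sum_eq_single i (fun j _ hj => ?_) fun h => (h hi).elim]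
    · simp [unitVec]
    · simp [unitVec, hj.symm]
  rw [perturbMatrix_col, restVec_some, h]
  simp [hi]

omit [Fintype I] in
theorem perturbMatrix_col_none_eq_diag (D : Finset I) (β : ℝ) :
    (perturbMatrix D β).col none = (perturbMatrix D β).diag := by
  have hd : ∀ o, (perturbMatrix D β).diag o = (perturbMatrix D β).col o o := fun _ => rfl
  ext o
  rw [hd]
  rcases o with _ | ⟨i, p⟩
  · rfl
  by_cases hp : p = 1
  · subst hp
    by_cases hi : i ∈ D
    · rw [perturbMatrix_col_of_mem hi, perturbMatrix_col_none]
      simp only [Pi.add_apply, Pi.smul_apply, restVec_some, sum_unitVec_apply]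
      simp [hi, unitVec]
    · rw [perturbMatrix_col_of_notMem hi]
  · rw [perturbMatrix_col_of_ne hp, perturbMatrix_col_none]
    simp only [Pi.add_apply, Pi.smul_apply, restVec_some, sum_unitVec_apply]
    simp [hp]

theorem tightMatrix_col_none :
    (tightMatrix r V U).col none = ∑ t ∈ tightIndices r V U, homogVec (tightSet t) := by
  ext o
  simp [tightMatrix, Matrix.sum_apply, Matrix.vecMulVec_apply, Finset.sum_apply]

theorem tightMatrix_col_some (w : I × Fin 4) :
    (tightMatrix r V U).col (some w) =
      ∑ t ∈ (tightIndices r V U).filter (fun t => tightSet t w = 1), homogVec (tightSet t) := by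
  ext o
  simp only [tightMatrix, Matrix.col_apply, Matrix.sum_apply, Matrix.vecMulVec_apply,
    Finset.sum_apply, Finset.sum_filter]
  refine Finset.sum_congr rfl fun t _ => ?_
  rcases tightSet_zero_or_one t w with h | h <;> simp [h]

theorem tightMatrix_col_none_sub (w : I × Fin 4) :
    (tightMatrix r V U).col none - (tightMatrix r V U).col (some w) =
      ∑ t ∈ (tightIndices r V U).filter (fun t => ¬ tightSet t w = 1), homogVec (tightSet t) := by
  rw [tightMatrix_col_none, tightMatrix_col_some, sub_eq_iff_eq_add,
    add_comm, Finset.sum_filter_add_sum_filter_not]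

theorem tightMatrix_col_none_eq_diag :
    (tightMatrix r V U).col none = (tightMatrix r V U).diag := by
  ext o
  simp only [tightMatrix, Matrix.col_apply, Matrix.diag_apply, Matrix.sum_apply,
    Matrix.vecMulVec_apply]
  refine Finset.sum_congr rfl fun t _ => ?_
  rcases o with _ | w
  · rfl
  · rcases tightSet_zero_or_one t w with h | h <;> simp [h]

/-- `restVec (V \ U)` is the incidence vector of a stable set, the middles outside `V \ U`, and
integral points survive every iteration. -/
theorem restVec_mem_homogCone (m : ℕ) :
    restVec (V \ U) ∈ homogCone (LSPlus^[m] (stretchPoly r V U)) := by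
  have h : restVec (V \ U) = homogVec (fun w => restVec (V \ U) (some w)) := by
    ext o
    cases o with
    | none => exact restVec_none _
    | some w => rfl
  rw [h]
  refine homogVec_mem_homogCone (mem_LSPlus_iterate_of_integral ?_ ?_ m)
  · constructor
    · rintro ⟨i, p⟩
      rw [restVec_some]
      split_ifs <;> norm_num
    · rintro ⟨i, p⟩
      rw [restVec_some]
      split_ifs <;> norm_num
    · simp [restVec_some]
    · intro i
      simp only [restVec_some]
      split_ifs <;> simp_all
    · intro i
      simp only [restVec_some]
      split_ifs <;> simp_all
    · simp [restVec_some]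
    · intro i hi
      simp [restVec_some, hi]
    · intro i hi
      simp [restVec_some, hi]
  · rintro ⟨i, p⟩
    simp only [restVec_some]
    split_ifs <;> simp

omit [Fintype I] in
theorem IsStretchPoint.update_mid {x : I × Fin 4 → ℝ} (hx : IsStretchPoint r V U x) {j : I}
    (hj : j ∈ V) (hjU : j ∉ U) : IsStretchPoint r V U (Function.update x (j, 1) 0) := by
  have hle : ∀ w, Function.update x (j, 1) 0 w ≤ x w := fun w => by
    by_cases h : w = (j, 1)
    · subst h; simpa using hx.nonneg _
    · simp [h]
  have hne : ∀ i p, i ≠ j → Function.update x (j, 1) 0 (i, p) = x (i, p) := fun i p h =>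
    Function.update_of_ne (by simp [h]) _ _
  refine ⟨fun w => ?_, fun w => (hle w).trans (hx.le_one w), fun i => ?_,
    fun i => (add_le_add (hle _) (hle _)).trans (hx.edge01 i),
    fun i => (add_le_add (hle _) (hle _)).trans (hx.edge12 i),
    fun i l h => (add_le_add (hle _) (hle _)).trans (hx.edge02 i l h), fun i hi => ?_,
    fun i hi => ?_⟩
  · by_cases h : w = (j, 1)
    · subst h; simp
    · simpa [h] using hx.nonneg w
  · rw [Function.update_of_ne (by simp)]
    exact hx.three i
  · have h : i ≠ j := fun h => hi (h ▸ hj)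
    simp only [hne _ _ h]
    exact hx.inactive i hi
  · have h : i ≠ j := fun h => hjU (h ▸ hi)
    simp only [hne _ _ h]
    exact hx.unstretched i hi

theorem tightSet_mem_homogCone (hr : ∀ i j, r i j → ¬ r j i) (m : ℕ) {t : I × I × Fin 4}
    (ht : t ∈ tightIndices r V U) :
    homogVec (tightSet t) ∈ homogCone (LSPlus^[m] (stretchPoly r V U)) :=
  homogVec_mem_homogCone (mem_LSPlus_iterate_of_integral
    ((mem_tightIndices.1 ht).isStretchPoint hr) (tightSet_zero_or_one t) m)

/-- Replace the summand `t` by the stable set obtained on deleting `(j, 1)`. Only a stretched active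
`j` allows this deletion, as otherwise an equation of the polytope would fail. -/
theorem feasDir_neg_unitVec (hr : ∀ i j, r i j → ¬ r j i) (m : ℕ)
    {T : Finset (I × I × Fin 4)} (hT : T ⊆ tightIndices r V U) {t : I × I × Fin 4} (ht : t ∈ T)
    {j : I} (hj : j ∈ V) (hjU : j ∉ U) (htj : tightSet t (j, 1) = 1) :
    FeasDir (homogCone (LSPlus^[m] (stretchPoly r V U))) (∑ t ∈ T, homogVec (tightSet t))
      (-unitVec (j, 1)) := by
  have hc : Convex ℝ (LSPlus^[m] (stretchPoly r V U)) := convex_LSPlus_iterate convex_stretchPoly m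
  have hS := fun t ht => tightSet_mem_homogCone (V := V) (U := U) hr m (hT ht) (t := t)
  have hne : (LSPlus^[m] (stretchPoly r V U)).Nonempty :=
    ⟨_, homogVec_mem_homogCone_iff.1 (hS t ht)⟩
  have ha := sum_mem_homogCone hc hne T hS
  have h1 : homogVec (tightSet t) - unitVec (j, 1) =
      homogVec (Function.update (tightSet t) (j, 1) 0) := by
    ext o
    rcases o with _ | w
    · simp [unitVec]
    · by_cases h : w = (j, 1)
      · subst h; simp [unitVec, htj]
      · simp [unitVec, h]
  have h2 : homogVec (tightSet t) - unitVec (j, 1) ∈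
      homogCone (LSPlus^[m] (stretchPoly r V U)) := by
    rw [h1]
    refine homogVec_mem_homogCone (mem_LSPlus_iterate_of_integral
      (((mem_tightIndices.1 (hT ht)).isStretchPoint hr).update_mid hj hjU) (fun w => ?_) m)
    by_cases h : w = (j, 1)
    · subst h; simp
    · simpa [h] using tightSet_zero_or_one t w
  have h3 : FeasDir (homogCone (LSPlus^[m] (stretchPoly r V U)))
      (∑ t ∈ T, homogVec (tightSet t)) (-homogVec (tightSet t)) := by
    refine feasDir_neg_of_sub_mem hc ha ?_
    rw [← Finset.sum_erase_eq_sub ht]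
    exact sum_mem_homogCone hc hne _ fun s hs => hS s (Finset.mem_of_mem_erase hs)
  convert (feasDir_of_mem hc ha h2).add hc h3 using 1
  abel

/-- Let `y` be the violating point of the smaller clique. Both `y` and, by the spanning property,
`-(y + excess y • midVec)` are feasible directions, and they add up to a positive multiple of
`-midVec`. Adding `unitVec (j, 1) + midVec`, which lies in the tight span, gives the second claim.
-/
theorem feasDir_neg_midVec (hr : ∀ i j, r i j → ¬ r j i) (hI : Nonempty I) {m : ℕ}
    {T : Finset (I × I × Fin 4)} (hT : T ⊆ tightIndices r V U) (hV : V₀ ⊆ V)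
    (hU : ∀ u ∈ U, u ∈ V₀ → u ∈ U₀) (hT₀ : tightIndices r V₀ U₀ ⊆ T)
    (hp : ProperlyStretched r V₀ U₀) (hb : HasBeyondPoint r m V₀ U₀) :
    FeasDir (homogCone (LSPlus^[m] (stretchPoly r V U))) (∑ t ∈ T, homogVec (tightSet t))
      (-midVec) ∧ ∀ j ∈ V₀, j ∉ U₀ →
    FeasDir (homogCone (LSPlus^[m] (stretchPoly r V U))) (∑ t ∈ T, homogVec (tightSet t))
      (unitVec (j, 1)) := by
  have hirr : ∀ i, ¬ r i i := fun i h => hr i i h h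
  have hc : Convex ℝ (LSPlus^[m] (stretchPoly r V U)) := convex_LSPlus_iterate convex_stretchPoly m
  have hS := fun t ht => tightSet_mem_homogCone (V := V) (U := U) hr m (hT ht) (t := t)
  obtain ⟨y, hy, hy'⟩ := hb
  have hyP : y ∈ LSPlus^[m] (stretchPoly r V U) :=
    LSPlus_iterate_mono m (stretchPoly_mono hV hU) hy
  have hlin : InLinHull V₀ U₀ (homogVec y) :=
    IsStretchPoint.inLinHull (LSPlus_iterate_subset convex_stretchPoly m hy)
  have hspan : ∀ x ∈ tightSpan r V₀ U₀, FeasDir (homogCone (LSPlus^[m] (stretchPoly r V U)))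
      (∑ t ∈ T, homogVec (tightSet t)) x := fun x hx =>
    feasDir_of_mem_span hc ⟨y, hyP⟩ T hS
      (Submodule.span_mono (Set.image_mono (by exact_mod_cast hT₀)) hx)
  have hex : 0 < excess (homogVec y) := by
    rw [excess_homogVec]; linarith
  have hmid : FeasDir (homogCone (LSPlus^[m] (stretchPoly r V U)))
      (∑ t ∈ T, homogVec (tightSet t)) (-midVec) := by
    have h1 := hspan _ (Submodule.neg_mem _ (hp.add_excess_smul_mem hirr hlin))
    have ha := h1.base_mem
    have h2 := (feasDir_of_mem hc ha (homogVec_mem_homogCone hyP)).add hc h1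
    have h3 := h2.smul (inv_pos.2 hex).le
    convert h3 using 1
    rw [neg_add, add_neg_cancel_left, smul_neg, smul_smul, inv_mul_cancel₀ hex.ne', one_smul]
  refine ⟨hmid, fun j hj hjU => ?_⟩
  convert (hspan _ (hp.unitVec_add_midVec_mem hirr hj hjU (p := 1) (by decide))).add hc hmid using 1
  abel

theorem feasDir_neg_perturbMatrix_col_none (hr : ∀ i j, r i j → ¬ r j i) (hI : Nonempty I) {m : ℕ}
    {T : Finset (I × I × Fin 4)} (hT : T ⊆ tightIndices r V U) (hV : V₀ ⊆ V)
    (hU : ∀ u ∈ U, u ∈ V₀ → u ∈ U₀) (hT₀ : tightIndices r V₀ U₀ ⊆ T)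
    (hp : ProperlyStretched r V₀ U₀) (hb : HasBeyondPoint r m V₀ U₀)
    (hmid : ∀ j ∈ V, j ∉ U → ∃ t ∈ T, tightSet t (j, 1) = 1) {β : ℝ} (hβ : 1 ≤ β) :
    FeasDir (homogCone (LSPlus^[m] (stretchPoly r V U))) (∑ t ∈ T, homogVec (tightSet t))
      (-(perturbMatrix (V \ U) β).col none) := by
  have hc : Convex ℝ (LSPlus^[m] (stretchPoly r V U)) := convex_LSPlus_iterate convex_stretchPoly m
  have h1 := (feasDir_neg_midVec hr hI hT hV hU hT₀ hp hb).1
  have h2 := (FeasDir.sum hc h1.base_mem (V \ U) (x := fun j => -unitVec (j, 1)) fun j hj => by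
    rw [Finset.mem_sdiff] at hj
    obtain ⟨t, ht, htj⟩ := hmid j hj.1 hj.2
    exact feasDir_neg_unitVec hr m hT ht hj.1 hj.2 htj).smul (sub_nonneg.2 hβ)
  convert h1.add hc h2 using 1
  -- The column equals `midVec + (β - 1) • ∑ unitVec (j, 1)`, so both negated terms are available
  -- when `β ≥ 1`.
  rw [perturbMatrix_col_none, restVec, Finset.sum_neg_distrib]
  module

omit [Fintype I] in
theorem exists_core_index (hV : 3 ≤ V.card) (i j : I) : ∃ v ∈ V, v ≠ i ∧ v ≠ j := by
  have : (({i, j} : Finset I)).card < V.card := (Finset.card_le_two).trans_lt hV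
  obtain ⟨v, hv, h⟩ := Finset.exists_mem_notMem_of_card_lt_card this
  simp only [Finset.mem_insert, Finset.mem_singleton, not_or] at h
  exact ⟨v, hv, h⟩

omit [Fintype I] in
theorem tightSet_core_of_ne {v i : I} (h : i ≠ v) (p : Fin 4) :
    tightSet (v, v, 1) (i, p) = if p = 1 then 1 else 0 := by
  simp [tightSet, h]

/-- The lifting step: beyond points for the cliques with one vertex less give a beyond point of the
next relaxation. -/
theorem HasBeyondPoint.step (hr : ∀ i j, r i j → ¬ r j i) {m : ℕ} (hV : 3 ≤ V.card)
    (hD : (V \ U).Nonempty) (hp : ProperlyStretched r V U)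
    (h1 : ∀ i ∈ V, i ∉ U → ProperlyStretched r (V.erase i) U ∧ HasBeyondPoint r m (V.erase i) U)
    (h2 : ∀ u ∈ U, ∃ U', U.erase u ⊆ U' ∧ ProperlyStretched r (V.erase u) U' ∧
      HasBeyondPoint r m (V.erase u) U') :
    HasBeyondPoint r (m + 1) V U := by
  have hirr : ∀ i, ¬ r i i := fun i h => hr i i h h
  have hI : Nonempty I := ⟨hD.choose⟩
  have hc : Convex ℝ (LSPlus^[m] (stretchPoly r V U)) := convex_LSPlus_iterate convex_stretchPoly m
  set K := homogCone (LSPlus^[m] (stretchPoly r V U)) with hK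
  have hrest : restVec (V \ U) ∈ K := restVec_mem_homogCone m
  have hne : (LSPlus^[m] (stretchPoly r V U)).Nonempty := by
    obtain ⟨_, _, x, hx, _⟩ := hrest
    exact ⟨x, hx⟩
  have hbase : ∀ T ⊆ tightIndices r V U, ∑ t ∈ T, homogVec (tightSet t) ∈ K := fun T hT =>
    sum_mem_homogCone hc hne T fun t ht => tightSet_mem_homogCone hr m (hT ht)
  -- a smaller clique avoiding a given vertex
  have hsub : ∀ i, ∃ V₀ U₀, i ∉ V₀ ∧ V₀ ⊆ V ∧ (∀ u ∈ U, u ∈ V₀ → u ∈ U₀) ∧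
      ProperlyStretched r V₀ U₀ ∧ HasBeyondPoint r m V₀ U₀ := by
    intro i
    by_cases hiU : i ∈ U
    · obtain ⟨U', hU', hp', hb'⟩ := h2 i hiU
      exact ⟨V.erase i, U', Finset.notMem_erase i V, Finset.erase_subset i V,
        fun u hu hu' => hU' (Finset.mem_erase.2 ⟨(Finset.mem_erase.1 hu').1, hu⟩), hp', hb'⟩
    · by_cases hi : i ∈ V
      · obtain ⟨hp', hb'⟩ := h1 i hi hiU
        exact ⟨V.erase i, U, Finset.notMem_erase i V, Finset.erase_subset i V,
          fun u hu _ => hu, hp', hb'⟩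
      · obtain ⟨j, hj⟩ := hD
        rw [Finset.mem_sdiff] at hj
        obtain ⟨hp', hb'⟩ := h1 j hj.1 hj.2
        exact ⟨V.erase j, U, fun h => hi (Finset.mem_of_mem_erase h), Finset.erase_subset j V,
          fun u hu _ => hu, hp', hb'⟩
  set d : ℝ := ((V \ U).card : ℝ) with hd
  have hd1 : 1 ≤ d := by
    rw [hd]; exact_mod_cast hD.card_pos
  -- The first column of `B` has excess `β d - d - 1`, which must be negative, whereas
  -- `quadratic_bound` needs `β d` large enough. The choice `β d = d + 1/2` meets both requirements.
  set β : ℝ := 1 + 1 / (2 * d) with hβdef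
  have hβ : β * d = d + 1 / 2 := by
    rw [hβdef]; field_simp
  have hβ1 : 1 ≤ β := by
    rw [hβdef]; have : 0 ≤ 1 / (2 * d) := by positivity
    linarith
  have hβ2 : β ≤ 2 := by
    rw [hβdef]
    have : 1 / (2 * d) ≤ 1 := by rw [div_le_one (by positivity)]; linarith
    linarith
  set B := perturbMatrix (V \ U) β with hB
  set A := tightMatrix r V U with hA
  have hcol : ∀ w : I × Fin 4, FeasDir K (A.col (some w)) (-B.col (some w)) ∧
      FeasDir K (A.col none - A.col (some w)) (-(B.col none - B.col (some w))) := by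
    rintro ⟨i, p⟩
    rw [hA, tightMatrix_col_none_sub, tightMatrix_col_some]
    have hT1 := Finset.filter_subset (fun t => tightSet t (i, p) = 1) (tightIndices r V U)
    have hT0 := Finset.filter_subset (fun t => ¬ tightSet t (i, p) = 1) (tightIndices r V U)
    obtain ⟨V₀, U₀, hi0, hV0, hU0, hp0, hb0⟩ := hsub i
    have hmono := tightIndices_mono (r := r) hV0 hU0
    by_cases hp1 : p = 1
    · subst hp1
      by_cases hi : i ∈ V \ U
      · rw [hB, perturbMatrix_col_of_mem hi]
        rw [Finset.mem_sdiff] at hi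
        obtain ⟨hp', hb'⟩ := h1 i hi.1 hi.2
        have hsplit : restVec (V \ U) + unitVec (i, 1) =
            midVec - ∑ j ∈ (V \ U).erase i, unitVec (j, 1) := by
          rw [restVec, ← Finset.add_sum_erase _ _ (Finset.mem_sdiff.2 hi)]
          abel
        constructor
        -- The negated column is `β • (-midVec + ∑ unitVec (j, 1))` over the stretched `j ≠ i`; the
        -- clique without `i` provides every term.
        · have hT₀ : tightIndices r (V.erase i) U ⊆
              (tightIndices r V U).filter (fun t => tightSet t (i, 1) = 1) := fun t ht => by
            refine Finset.mem_filter.2 ⟨tightIndices_mono (Finset.erase_subset i V)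
              (fun u hu _ => hu) ht, ?_⟩
            rw [(mem_tightIndices.1 ht).apply_of_notMem (Finset.notMem_erase i V)]
            simp
          obtain ⟨hm, hu⟩ := feasDir_neg_midVec hr hI hT1 (Finset.erase_subset i V)
            (fun u hu _ => hu) hT₀ hp' hb'
          have hs := FeasDir.sum hc hm.base_mem ((V \ U).erase i) (x := fun j => unitVec (j, 1))
            fun j hj => by
              rw [Finset.mem_erase, Finset.mem_sdiff] at hj
              exact hu j (Finset.mem_erase.2 ⟨hj.1, hj.2.1⟩) hj.2.2
          convert (hm.add hc hs).smul (zero_le_one.trans hβ1) using 1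
          rw [hsplit]
          module
        -- The direction is `(β - 1) • restVec - β • ∑ unitVec (j, 1)` over the stretched `j ≠ i`.
        -- Here no smaller clique is needed: the core set of `i` avoids `(i, 1)` and contains each
        -- `(j, 1)`.
        · have ha := hbase _ hT0
          have hs := FeasDir.sum hc ha ((V \ U).erase i) (x := fun j => -unitVec (j, 1))
            fun j hj => by
              rw [Finset.mem_erase, Finset.mem_sdiff] at hj
              refine feasDir_neg_unitVec hr m hT0 (t := (i, i, 1)) ?_ hj.2.1 hj.2.2 ?_
              · exact Finset.mem_filter.2 ⟨core_mem_tightIndices hi.1 i, by simp [tightSet]⟩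
              · simp [tightSet_core_of_ne hj.1]
          have hr' := (feasDir_of_mem hc ha hrest).smul (sub_nonneg.2 hβ1)
          convert hr'.add hc (hs.smul (zero_le_one.trans hβ1)) using 1
          rw [perturbMatrix_col_none, ← Finset.add_sum_erase _ _ (Finset.mem_sdiff.2 hi),
            Finset.sum_neg_distrib]
          module
      · rw [hB, perturbMatrix_col_of_notMem hi, sub_self, neg_zero]
        refine ⟨?_, feasDir_zero (hbase _ hT0)⟩
        refine feasDir_neg_perturbMatrix_col_none hr hI hT1 hV0 hU0 (fun t ht => ?_) hp0 hb0
          (fun j _ _ => ?_) hβ1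
        · refine Finset.mem_filter.2 ⟨hmono ht, ?_⟩
          rw [(mem_tightIndices.1 ht).apply_of_notMem hi0]
          simp
        -- The core set of a third vertex `v` contains both `(i, 1)` and `(j, 1)`; this uses `3 ≤
        -- V.card`.
        · obtain ⟨v, hv, hvi, hvj⟩ := exists_core_index hV i j
          exact ⟨(v, v, 1), Finset.mem_filter.2 ⟨core_mem_tightIndices hv v,
            by simp [tightSet_core_of_ne hvi.symm]⟩, by simp [tightSet_core_of_ne hvj.symm]⟩
    · rw [hB, perturbMatrix_col_of_ne hp1, sub_zero, neg_zero]
      refine ⟨feasDir_zero (hbase _ hT1), ?_⟩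
      refine feasDir_neg_perturbMatrix_col_none hr hI hT0 hV0 hU0 (fun t ht => ?_) hp0 hb0
        (fun j _ _ => ?_) hβ1
      · refine Finset.mem_filter.2 ⟨hmono ht, ?_⟩
        rw [(mem_tightIndices.1 ht).apply_of_notMem hi0]
        simp [hp1]
      · obtain ⟨v, hv, hvi, hvj⟩ := exists_core_index hV i j
        exact ⟨(v, v, 1), Finset.mem_filter.2 ⟨core_mem_tightIndices hv v,
          by simp [tightSet_core_of_ne hvi.symm, hp1]⟩, by simp [tightSet_core_of_ne hvj.symm]⟩
  -- a common step length
  have hev : ∃ ε : ℝ, 0 < ε ∧ ε < 1 ∧ (A - ε • B).PosSemidef ∧ ∀ w : I × Fin 4,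
      A.col (some w) + ε • (-B.col (some w)) ∈ K ∧
      A.col none - A.col (some w) + ε • (-(B.col none - B.col (some w))) ∈ K := by
    have hF : ∀ {p : ℝ → Prop}, (∃ ε₀ > 0, ∀ ε : ℝ, 0 ≤ ε → ε ≤ ε₀ → p ε) →
        ∀ᶠ ε in nhdsWithin (0 : ℝ) (Set.Ioi 0), p ε := by
      rintro p ⟨ε₀, h0, h⟩
      filter_upwards [Ioc_mem_nhdsGT h0] with ε hε
      exact h ε hε.1.le hε.2
    have e1 := hF (posSemidef_tightMatrix_sub (r := r) hirr hp hβ hβ1 hβ2)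
    have e2 := Filter.eventually_all.2 fun w => (hF (hcol w).1).and (hF (hcol w).2)
    have e0 : ∀ᶠ ε in nhdsWithin (0 : ℝ) (Set.Ioi 0), ε ∈ Set.Ioo (0 : ℝ) 1 :=
      Ioo_mem_nhdsGT one_pos
    obtain ⟨ε, hε, hε1, hε2⟩ := (e0.and (e1.and e2)).exists
    exact ⟨ε, hε.1, hε.2, hε1, hε2⟩
  obtain ⟨ε, hε0, hε1, hpsd, hcols⟩ := hev
  have hcolY : ∀ o, (A - ε • B).col o = A.col o - ε • B.col o := fun o => rfl
  have hY : A - ε • B ∈ liftLSPlus (LSPlus^[m] (stretchPoly r V U)) := by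
    refine ⟨hpsd, ?_, fun w => ⟨?_, ?_⟩⟩
    · rw [hcolY, hA, hB, tightMatrix_col_none_eq_diag, perturbMatrix_col_none_eq_diag]
      rfl
    · convert (hcols w).1 using 1
      rw [hcolY]
      module
    · convert (hcols w).2 using 1
      rw [hcolY, hcolY]
      module
  have hA0 : A none none = (tightIndices r V U).card := by
    have := congrFun (tightMatrix_col_none (r := r) (V := V) (U := U)) none
    rw [Finset.sum_apply] at this
    simpa using this
  have hB0 : B none none = 1 := by
    have := congrFun (perturbMatrix_col_none (V \ U) β) none
    simpa [restVec_none, unitVec, Finset.sum_apply] using this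
  have hcard : (1 : ℝ) ≤ (tightIndices r V U).card := by
    obtain ⟨j, hj⟩ := hD
    have : 0 < (tightIndices r V U).card :=
      Finset.card_pos.2 ⟨_, core_mem_tightIndices (Finset.mem_sdiff.1 hj).1 j⟩
    exact_mod_cast this
  have hpos : 0 < (A - ε • B) none none := by
    simp only [Matrix.sub_apply, Matrix.smul_apply, smul_eq_mul, hA0, hB0]
    linarith
  have hexA : excess (A.col none) = 0 := by
    rw [hA, tightMatrix_col_none, map_sum]
    exact Finset.sum_eq_zero fun t ht => (mem_tightIndices.1 ht).excess_eq_zero hirr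
  have hexB : excess (B.col none) = -(1 / 2) := by
    rw [hB, perturbMatrix_col_none, restVec, map_add, map_sub, map_smul, map_sum, excess_midVec,
      Finset.sum_congr rfl fun i _ => excess_unitVec i (p := 1) (by decide), Finset.sum_const,
      nsmul_eq_mul, mul_one, smul_eq_mul, ← hd, hβ]
    ring
  have hex : excess ((A - ε • B).col none) = ε / 2 := by
    rw [hcolY, map_sub, map_smul, hexA, hexB, smul_eq_mul]
    ring
  refine ⟨fun w => (A - ε • B) (some w) none / (A - ε • B) none none, ?_, ?_⟩
  · rw [Function.iterate_succ_apply']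
    exact normalized_mem_LSPlus hY hpos
  · rw [← sub_pos, ← excess_homogVec]
    have : homogVec (fun w => (A - ε • B) (some w) none / (A - ε • B) none none) =
        ((A - ε • B) none none)⁻¹ • (A - ε • B).col none := by
      ext o
      cases o with
      | none => exact (inv_mul_cancel₀ hpos.ne').symm
      | some w => simp [div_eq_inv_mul]
    rw [this, map_smul, hex, smul_eq_mul]
    positivity

end Step

/-! ### Locally transitive tournaments -/

section Tournament

variable {I : Type*} [Fintype I] [DecidableEq I] {r : I → I → Prop}

/-- Each of the three active paths carries `3/2` and every inactive path carries `1`, for a total of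
`Fintype.card I + 3/2`. -/
theorem hasBeyondPoint_zero {V : Finset I} (U : Finset I) (hV : V.card = 3) :
    HasBeyondPoint r 0 V U := by
  refine ⟨fun w => if w.2 = 3 then 0 else if w.1 ∈ V then 1 / 2 else if w.2 = 1 then 1 else 0,
    ?_, ?_⟩
  · constructor <;> intros <;> (try simp only [Fin.isValue, Fin.reduceEq, if_false, if_true])
    · split_ifs <;> norm_num
    · split_ifs <;> norm_num
    · split_ifs <;> norm_num
    · split_ifs <;> norm_num
    · split_ifs <;> norm_num
    · simp_all
    · split_ifs <;> norm_num
  · have h : ∀ i : I, (if i ∈ V then (1 / 2 : ℝ) else 0) + (if i ∈ V then 1 / 2 else 1) +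
        (if i ∈ V then 1 / 2 else 0) = 1 + if i ∈ V then 1 / 2 else 0 := fun i => by
      split_ifs <;> norm_num
    simp only [pathSum, Fin.isValue, Fin.reduceEq, if_false, if_true, h]
    rw [Finset.sum_add_distrib, Finset.sum_ite_mem, Finset.univ_inter]
    simp [hV]
    norm_num

omit [DecidableEq I] in
theorem HasBeyondPoint.mono_unstretched {m : ℕ} {V U U' : Finset I}
    (h : HasBeyondPoint r m V U) (hU : U' ⊆ U) : HasBeyondPoint r m V U' := by
  obtain ⟨y, hy, hy'⟩ := h
  exact ⟨y, LSPlus_iterate_mono m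
    (stretchPoly_mono (Finset.Subset.refl V) fun u hu _ => hU hu) hy, hy'⟩

/-- If the stretched vertices form a transitive tournament, there are at most three unstretched
vertices, one of them dominated by all stretched vertices, and every stretched vertex is dominated
by an unstretched one, then the clique has a beyond point. -/
theorem hasBeyondPoint_of_transitive (hr : ∀ i j, r i j → ¬ r j i) (ρ : I → ℕ) (n : ℕ) :
    ∀ (V U : Finset I) (b : I), V.card = n + 3 → U ⊆ V → U.card ≤ 3 → b ∈ U →
      (∀ v ∈ V, v ∉ U → r v b) → (∀ v ∈ V, v ∉ U → ∃ a ∈ U, r a v) →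
      (∀ x ∈ V, x ∉ U → ∀ y ∈ V, y ∉ U → x ≠ y → ρ x ≤ ρ y → r x y) →
      HasBeyondPoint r n V U := by
  induction n with
  | zero => exact fun V U b hV _ _ _ _ _ _ => hasBeyondPoint_zero U hV
  | succ n ih =>
    intro V U b hV hUV hU hb hout hin hρ
    have hproper : ∀ V' : Finset I, U ⊆ V' → V' ⊆ V → ProperlyStretched r V' U := by
      intro V' h h' v hv hvU
      obtain ⟨a, ha, hav⟩ := hin v (h' hv) hvU
      exact ⟨⟨a, h ha, hav⟩, ⟨b, h hb, hout v (h' hv) hvU⟩⟩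
    have hD : (V \ U).Nonempty := by
      rw [← Finset.card_pos, Finset.card_sdiff_of_subset hUV]
      omega
    refine HasBeyondPoint.step hr (by omega) hD (hproper V hUV (Finset.Subset.refl V))
      (fun i hi hiU => ?_) (fun u hu => ?_)
    · have hUV' : U ⊆ V.erase i := fun u hu =>
        Finset.mem_erase.2 ⟨fun h => hiU (h ▸ hu), hUV hu⟩
      refine ⟨hproper _ hUV' (Finset.erase_subset i V), ih _ _ b ?_ hUV' hU hb ?_ ?_ ?_⟩
      · rw [Finset.card_erase_of_mem hi]; omega
      · exact fun v hv => hout v (Finset.mem_of_mem_erase hv)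
      · exact fun v hv => hin v (Finset.mem_of_mem_erase hv)
      · exact fun x hx hxU y hy => hρ x (Finset.mem_of_mem_erase hx) hxU y
          (Finset.mem_of_mem_erase hy)
    · suffices h : ∃ U' b', U.erase u ⊆ U' ∧ U' ⊆ V.erase u ∧ U'.card ≤ 3 ∧ b' ∈ U' ∧
          (∀ v ∈ V, v ∉ U → v ∉ U' → r v b') ∧ ∀ v ∈ V, v ∉ U → v ∉ U' → ∃ a ∈ U', r a v by
        obtain ⟨U', b', h1, h2, h3, h4, h5, h6⟩ := h
        have hnot : ∀ v ∈ V.erase u, v ∉ U' → v ∈ V ∧ v ∉ U := fun v hv hvU' =>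
          ⟨Finset.mem_of_mem_erase hv, fun h => hvU' (h1 (Finset.mem_erase.2
            ⟨(Finset.mem_erase.1 hv).1, h⟩))⟩
        have hin' : ∀ v ∈ V.erase u, v ∉ U' → ∃ a ∈ U', r a v := fun v hv hvU' =>
          h6 v (hnot v hv hvU').1 (hnot v hv hvU').2 hvU'
        have hout' : ∀ v ∈ V.erase u, v ∉ U' → r v b' := fun v hv hvU' =>
          h5 v (hnot v hv hvU').1 (hnot v hv hvU').2 hvU'
        refine ⟨U', h1, fun v hv hvU' => ?_, ih _ _ b' ?_ h2 h3 h4 hout' hin' ?_⟩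
        · obtain ⟨a, ha, hav⟩ := hin' v hv hvU'
          exact ⟨⟨a, h2 ha, hav⟩, ⟨b', h2 h4, hout' v hv hvU'⟩⟩
        · rw [Finset.card_erase_of_mem (hUV hu)]; omega
        · intro x hx hxU' y hy hyU'
          exact hρ x (hnot x hx hxU').1 (hnot x hx hxU').2 y (hnot y hy hyU').1 (hnot y hy hyU').2
      have hcard : (U.erase u).card ≤ 2 := by
        rw [Finset.card_erase_of_mem hu]; omega
      have hsub : U.erase u ⊆ V.erase u := Finset.erase_subset_erase u hUV
      have hins : ∀ c ∈ V, c ∉ U → insert c (U.erase u) ⊆ V.erase u := fun c hc hcU =>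
        Finset.insert_subset (Finset.mem_erase.2 ⟨fun h => hcU (h ▸ hu), hc⟩) hsub
      have hinsc : ∀ c, (insert c (U.erase u)).card ≤ 3 := fun c =>
        (Finset.card_insert_le _ _).trans (by omega)
      by_cases hub : u = b
      -- The last stretched vertex in the order `ρ` takes over the role of `b`. The removed vertex
      -- dominated no stretched vertex, so the in-neighbours are unaffected.
      · subst hub
        obtain ⟨c, hc, hmax⟩ := Finset.exists_max_image (V \ U) ρ hD
        rw [Finset.mem_sdiff] at hc
        refine ⟨insert c (U.erase u), c, Finset.subset_insert _ _, hins c hc.1 hc.2, hinsc c,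
          Finset.mem_insert_self _ _, fun v hv hvU hvU' => ?_, fun v hv hvU _ => ?_⟩
        · exact hρ v hv hvU c hc.1 hc.2 (fun h => hvU' (h ▸ Finset.mem_insert_self _ _))
            (hmax v (Finset.mem_sdiff.2 ⟨hv, hvU⟩))
        · obtain ⟨a, ha, hav⟩ := hin v hv hvU
          have : a ≠ u := fun h => hr _ _ (hout v hv hvU) (h ▸ hav)
          exact ⟨a, Finset.mem_insert_of_mem (Finset.mem_erase.2 ⟨this, ha⟩), hav⟩
      · have hb' : b ∈ U.erase u := Finset.mem_erase.2 ⟨Ne.symm hub, hb⟩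
        classical
        -- Unstretching the `ρ`-first vertex among those left without an unstretched in-neighbour
        -- gives all the others one, and restores at most the previous number of unstretched
        -- vertices.
        by_cases hF : ((V \ U).filter fun v => ∀ a ∈ U.erase u, ¬ r a v).Nonempty
        · obtain ⟨c, hc, hmin⟩ := Finset.exists_min_image _ ρ hF
          rw [Finset.mem_filter, Finset.mem_sdiff] at hc
          refine ⟨insert c (U.erase u), b, Finset.subset_insert _ _, hins c hc.1.1 hc.1.2, hinsc c,
            Finset.mem_insert_of_mem hb', fun v hv hvU _ => hout v hv hvU,
            fun v hv hvU hvU' => ?_⟩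
          by_cases hv' : ∀ a ∈ U.erase u, ¬ r a v
          · exact ⟨c, Finset.mem_insert_self _ _, hρ c hc.1.1 hc.1.2 v hv hvU
              (fun h => hvU' (h ▸ Finset.mem_insert_self _ _))
              (hmin v (Finset.mem_filter.2 ⟨Finset.mem_sdiff.2 ⟨hv, hvU⟩, hv'⟩))⟩
          · push Not at hv'
            obtain ⟨a, ha, hav⟩ := hv'
            exact ⟨a, Finset.mem_insert_of_mem ha, hav⟩
        · refine ⟨U.erase u, b, Finset.Subset.refl _, hsub, by omega, hb',
            fun v hv hvU _ => hout v hv hvU, fun v hv hvU _ => ?_⟩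
          by_contra! hv'
          exact hF ⟨v, Finset.mem_filter.2 ⟨Finset.mem_sdiff.2 ⟨hv, hvU⟩, hv'⟩⟩

/-- A tournament in which the in-neighbourhood and the out-neighbourhood of every vertex `v` are
transitive, being ordered by `ρ v`. -/
structure IsLocallyTransitive (r : I → I → Prop) (ρ : I → I → ℕ) : Prop where
  asymm : ∀ i j, r i j → ¬ r j i
  total : ∀ i j, i ≠ j → r i j ∨ r j i
  out_nbr : ∀ v x y, r v x → r v y → x ≠ y → ρ v x ≤ ρ v y → r x y
  in_nbr : ∀ v x y, r x v → r y v → x ≠ y → ρ v x ≤ ρ v y → r x y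

-- If some vertex has at most one out-neighbour in `V`, unstretch it together with that
-- out-neighbour and its first in-neighbour; the transitive case applies. Otherwise all in-degrees
-- and out-degrees in `V` are at least two, so deleting any vertex keeps the rest properly
-- stretched.
open Classical in
theorem IsLocallyTransitive.hasBeyondPoint {ρ : I → I → ℕ} (h : IsLocallyTransitive r ρ) (n : ℕ) :
    ∀ V : Finset I, V.card = n + 3 → HasBeyondPoint r n V ∅ := by
  induction n with
  | zero => exact fun V hV => hasBeyondPoint_zero ∅ hV
  | succ n ih =>
    intro V hV
    have hirr : ∀ i, ¬ r i i := fun i hi => h.asymm i i hi hi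
    have hcover : ∀ j, V ⊆ insert j (V.filter (r j) ∪ V.filter fun x => r x j) := by
      intro j v hv
      by_cases hvj : v = j
      · simp [hvj]
      · rcases h.total v j hvj with h' | h' <;> simp [hv, h']
    have hsum : ∀ j, V.card ≤ (V.filter (r j)).card + (V.filter fun x => r x j).card + 1 :=
      fun j => (Finset.card_le_card (hcover j)).trans ((Finset.card_insert_le _ _).trans
        (Nat.add_le_add_right (Finset.card_union_le _ _) 1))
    by_cases hsmall : ∃ j ∈ V, (V.filter (r j)).card ≤ 1
    · obtain ⟨j, hj, hj1⟩ := hsmall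
      have hN : (V.filter fun x => r x j).Nonempty := by
        rw [← Finset.card_pos]
        have := hsum j
        omega
      obtain ⟨a, ha, hmin⟩ := Finset.exists_min_image _ (ρ j) hN
      rw [Finset.mem_filter] at ha
      have hout : ∀ v ∈ V, v ∉ insert j (insert a (V.filter (r j))) →
          r v j ∧ v ≠ a := by
        intro v hv hvU
        simp only [Finset.mem_insert, Finset.mem_filter, not_or, not_and] at hvU
        exact ⟨(h.total v j hvU.1).resolve_right (hvU.2.2 hv), hvU.2.1⟩
      refine (hasBeyondPoint_of_transitive h.asymm (ρ j) (n + 1) V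
        (insert j (insert a (V.filter (r j)))) j hV ?_ ?_ (Finset.mem_insert_self _ _)
        (fun v hv hvU => (hout v hv hvU).1) (fun v hv hvU => ?_) ?_).mono_unstretched
        (Finset.empty_subset _)
      · exact Finset.insert_subset hj (Finset.insert_subset ha.1 (Finset.filter_subset _ _))
      · refine (Finset.card_insert_le _ _).trans (Nat.succ_le_succ ?_)
        exact (Finset.card_insert_le _ _).trans (Nat.succ_le_succ hj1)
      · obtain ⟨h1, h2⟩ := hout v hv hvU
        exact ⟨a, by simp, h.in_nbr j a v ha.2 h1 h2.symm
          (hmin v (Finset.mem_filter.2 ⟨hv, h1⟩))⟩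
      · intro x hx hxU y hy hyU hne hle
        exact h.in_nbr j x y (hout x hx hxU).1 (hout y hy hyU).1 hne hle
    · push Not at hsmall
      have hin : ∀ j ∈ V, 1 < (V.filter fun x => r x j).card := by
        intro j hj
        by_contra! hj1
        have hN : (V.filter (r j)).Nonempty := Finset.card_pos.1 (by have := hsmall j hj; omega)
        -- Every out-neighbour of the last out-neighbour `m` of `j` dominates `j`, so an in-degree
        -- of `j` at most one would bound the out-degree of `m` by one.
        obtain ⟨m, hm, hmax⟩ := Finset.exists_max_image _ (ρ j) hN
        rw [Finset.mem_filter] at hm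
        refine absurd (hsmall m hm.1) (not_lt.2 ((Finset.card_le_card fun x hx => ?_).trans hj1))
        rw [Finset.mem_filter] at hx ⊢
        refine ⟨hx.1, ?_⟩
        have hxj : x ≠ j := fun e => h.asymm _ _ hm.2 (e ▸ hx.2)
        refine (h.total x j hxj).resolve_right fun hjx => ?_
        have hxm : x ≠ m := fun e => hirr m (e ▸ hx.2)
        exact h.asymm _ _ hx.2 (h.out_nbr j x m hjx hm.2 hxm
          (hmax x (Finset.mem_filter.2 ⟨hx.1, hjx⟩)))
      have hproper : ∀ i, ProperlyStretched r (V.erase i) ∅ := by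
        intro i j hj _
        have hj := Finset.mem_of_mem_erase hj
        obtain ⟨v, hv, hvi⟩ := Finset.exists_mem_ne (hin j hj) i
        obtain ⟨w, hw, hwi⟩ := Finset.exists_mem_ne (hsmall j hj) i
        rw [Finset.mem_filter] at hv hw
        exact ⟨⟨v, Finset.mem_erase.2 ⟨hvi, hv.1⟩, hv.2⟩, ⟨w, Finset.mem_erase.2 ⟨hwi, hw.1⟩, hw.2⟩⟩
      refine HasBeyondPoint.step h.asymm (by omega) ?_ (fun j hj _ => ?_)
        (fun i hi _ => ⟨hproper i, ih _ ?_⟩) (fun u hu => absurd hu (Finset.notMem_empty u))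
      · rw [Finset.sdiff_empty, ← Finset.card_pos]; omega
      · obtain ⟨v, hv, -⟩ := Finset.exists_mem_ne (hin j hj) j
        obtain ⟨w, hw, -⟩ := Finset.exists_mem_ne (hsmall j hj) j
        rw [Finset.mem_filter] at hv hw
        exact ⟨⟨v, hv⟩, ⟨w, hw⟩⟩
      · rw [Finset.card_erase_of_mem hi]; omega

end Tournament

/-! ### The graph `B_k` -/

section GraphB

variable {k : ℕ}

/-- The rotational tournament. -/
def rotRel (k : ℕ) (i j : Fin k) : Prop :=
  1 ≤ (j - i : Fin k).val ∧ (j - i : Fin k).val ≤ (k - 1) / 2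

theorem Fin.val_sub_cases (a b : Fin k) :
    (b.val ≤ a.val ∧ (a - b).val = a.val - b.val) ∨
      (a.val < b.val ∧ (a - b).val = k + a.val - b.val) := by
  rcases le_or_gt b a with h | h
  · exact Or.inl ⟨h, Fin.sub_val_of_le h⟩
  · refine Or.inr ⟨h, ?_⟩
    rw [Fin.coe_sub_iff_lt.2 h]

/-- In- and out-neighbourhoods are arcs of `(k - 1) / 2` consecutive residues, short enough for the
cyclic order to be linear on them; oddness of `k` makes the tournament total. -/
theorem isLocallyTransitive_rotRel (hk : Odd k) :
    IsLocallyTransitive (rotRel k) fun v x => (x - v).val := by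
  obtain ⟨h, rfl⟩ := hk
  have hh : (2 * h + 1 - 1) / 2 = h := by omega
  have hne : ∀ x y : Fin (2 * h + 1), x ≠ y → x.val ≠ y.val := fun x y hxy hv => hxy (Fin.ext hv)
  constructor
  · intro i j
    simp only [rotRel, hh]
    have := Fin.val_sub_cases i j
    have := Fin.val_sub_cases j i
    have := i.isLt
    have := j.isLt
    omega
  · intro i j hij
    simp only [rotRel, hh]
    have := hne i j hij
    have := Fin.val_sub_cases i j
    have := Fin.val_sub_cases j i
    have := i.isLt
    have := j.isLt
    omega
  all_goals
    intro v x y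
    simp only [rotRel, hh]
    intro h1 h2 hxy h3
    have := hne x y hxy
    have := Fin.val_sub_cases x v
    have := Fin.val_sub_cases v x
    have := Fin.val_sub_cases y v
    have := Fin.val_sub_cases v y
    have := Fin.val_sub_cases y x
    have := v.isLt
    have := x.isLt
    have := y.isLt
    omega

theorem stretchPoly_subset_fracPolytope :
    stretchPoly (rotRel k) Finset.univ ∅ ⊆ (graphB k).fracPolytope := by
  intro x hx
  refine ⟨fun w => ⟨hx.nonneg w, hx.le_one w⟩, ?_⟩
  have key : ∀ u v, edgeRelB k u v → x u + x v ≤ 1 := by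
    rintro ⟨i, p⟩ ⟨j, q⟩ (⟨rfl, h⟩ | ⟨h, hr⟩)
    · have h3 := hx.three i
      rcases h with ⟨rfl, rfl⟩ | ⟨rfl, rfl⟩ | ⟨rfl, rfl⟩ | ⟨rfl, rfl⟩
      · exact hx.edge01 i
      · exact hx.edge12 i
      · rw [h3, add_zero]; exact hx.le_one _
      · rw [h3, zero_add]; exact hx.le_one _
    · rcases h with ⟨rfl, rfl⟩ | ⟨rfl, rfl⟩
      · exact hx.edge02 i j hr
      · rw [hx.three j, add_zero]; exact hx.le_one _
  intro u v huv
  rcases huv.2 with h | h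
  · exact key u v h
  · rw [add_comm]; exact key v u h

theorem pathSum_le_of_mem_integerHull (hk : Odd k) {x : Fin k × Fin 4 → ℝ}
    (hx : x ∈ integerHull (graphB k).fracPolytope) : pathSum x ≤ k + 1 := by
  have hlin : IsLinearMap ℝ (pathSum : (Fin k × Fin 4 → ℝ) → ℝ) := by
    refine ⟨fun x y => ?_, fun c x => ?_⟩
    · simp only [pathSum, Pi.add_apply, ← Finset.sum_add_distrib]
      exact Finset.sum_congr rfl fun i _ => by ring
    · simp only [pathSum, Pi.smul_apply, smul_eq_mul, Finset.mul_sum]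
      exact Finset.sum_congr rfl fun i _ => by ring
  refine convexHull_min (t := {x | pathSum x ≤ k + 1}) ?_ (convex_halfSpace_le hlin _) hx
  rintro y ⟨⟨hb, he⟩, h01⟩
  have hedge : ∀ u v, u ≠ v → edgeRelB k u v → y u + y v ≤ 1 := fun u v hne h =>
    he u v ⟨hne, Or.inl h⟩
  have e01 : ∀ i, y (i, 0) + y (i, 1) ≤ 1 := fun i =>
    hedge _ _ (by simp) (Or.inl ⟨rfl, Or.inl ⟨rfl, rfl⟩⟩)
  have e12 : ∀ i, y (i, 1) + y (i, 2) ≤ 1 := fun i =>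
    hedge _ _ (by simp) (Or.inl ⟨rfl, Or.inr (Or.inl ⟨rfl, rfl⟩)⟩)
  have e02 : ∀ i j, rotRel k i j → y (i, 0) + y (j, 2) ≤ 1 := fun i j h =>
    hedge _ _ (by simp) (Or.inr ⟨Or.inl ⟨rfl, rfl⟩, h⟩)
  have htwo : ∀ i, y (i, 0) + y (i, 1) + y (i, 2) ≤ 2 := fun i => by
    linarith [e01 i, (hb (i, 2)).2]
  have hdouble : ∀ i, 1 < y (i, 0) + y (i, 1) + y (i, 2) → y (i, 0) = 1 ∧ y (i, 2) = 1 := by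
    intro i hi
    have h1 := e01 i
    have h2 := e12 i
    rcases h01 (i, 0) with h | h <;> rcases h01 (i, 2) with h' | h' <;>
      first | exact ⟨h, h'⟩ | (exfalso; linarith)
  change pathSum y ≤ k + 1
  by_cases hex : ∃ i, 1 < y (i, 0) + y (i, 1) + y (i, 2)
  · obtain ⟨i, hi⟩ := hex
    obtain ⟨hi0, hi2⟩ := hdouble i hi
    have hle : ∀ j, y (j, 0) + y (j, 1) + y (j, 2) ≤ 1 + if j = i then 1 else 0 := by
      intro j
      by_cases hji : j = i
      · subst hji
        have := htwo j
        simp only [if_true]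
        linarith
      · rw [if_neg hji, add_zero]
        by_contra! hj
        -- Two paths with both ends chosen would contain an edge, whichever way the tournament
        -- orients the pair.
        obtain ⟨hj0, hj2⟩ := hdouble j hj
        rcases (isLocallyTransitive_rotRel hk).total i j (Ne.symm hji) with h | h
        · linarith [e02 i j h]
        · linarith [e02 j i h]
    refine (Finset.sum_le_sum fun j _ => hle j).trans ?_
    rw [Finset.sum_add_distrib]
    simp
  · push Not at hex
    refine (Finset.sum_le_sum fun j _ => hex j).trans ?_
    simp

theorem le_lsPlusRank_graphB (hk : Odd k) (hk3 : 3 ≤ k) : k - 2 ≤ (graphB k).lsPlusRank := by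
  have : Nonempty (Fin k × Fin 4) := ⟨(⟨0, by omega⟩, 0)⟩
  -- Three of the `k` paths are used up at level zero, leaving level `k - 3`; the strict inequality
  -- for the rank supplies the final one.
  obtain ⟨y, hy, hy'⟩ := (isLocallyTransitive_rotRel hk).hasBeyondPoint (k - 3) Finset.univ
    (by simp; omega)
  rw [Fintype.card_fin] at hy'
  have h := lt_LSPlusRank (graphB k).convex_fracPolytope (fun x hx => hx.1)
    (LSPlus_iterate_mono _ stretchPoly_subset_fracPolytope hy)
    fun hmem => (pathSum_le_of_mem_integerHull hk hmem).not_gt hy'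
  have : k - 3 < (graphB k).lsPlusRank := h
  omega

/-- A permutation of the vertices that preserves edges in both directions is an automorphism. -/
def graphBIso (e : Fin k × Fin 4 ≃ Fin k × Fin 4)
    (h : ∀ u v, edgeRelB k u v → edgeRelB k (e u) (e v) ∨ edgeRelB k (e v) (e u))
    (h' : ∀ u v, edgeRelB k u v → edgeRelB k (e.symm u) (e.symm v) ∨
      edgeRelB k (e.symm v) (e.symm u)) : graphB k ≃g graphB k where
  toEquiv := e
  map_rel_iff' := by
    intro u v
    simp only [graphB, SimpleGraph.fromRel_adj, ne_eq, EmbeddingLike.apply_eq_iff_eq]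
    refine and_congr_right fun _ => ⟨?_, ?_⟩
    · rintro (h1 | h1)
      · simpa using h' _ _ h1
      · simpa [or_comm] using h' _ _ h1
    · rintro (h1 | h1)
      · exact h _ _ h1
      · exact (h _ _ h1).symm

/-- Rotations move the first coordinate. The swap `0 ↔ 1`, `2 ↔ 3` and the map `(i, p) ↦ (-i, p +
2)` connect the four classes; the negation is needed because `p + 2` reverses the tournament edges.
-/
theorem isVertexTransitive_graphB (hk3 : 3 ≤ k) : (graphB k).IsVertexTransitive := by
  have : NeZero k := ⟨by omega⟩
  let R : Fin k × Fin 4 → Fin k × Fin 4 → Prop := fun u v => ∃ φ : graphB k ≃g graphB k, φ u = v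
  have hsymm : ∀ u v, R u v → R v u := by
    rintro u v ⟨φ, rfl⟩
    exact ⟨φ.symm, by simp⟩
  have htrans : ∀ u v w, R u v → R v w → R u w := by
    rintro u v w ⟨φ, rfl⟩ ⟨ψ, rfl⟩
    exact ⟨φ.trans ψ, rfl⟩
  have hrot : ∀ i j p, R (i, p) (j, p) := by
    intro i j p
    refine ⟨graphBIso (Equiv.prodCongr (Equiv.addRight (j - i)) (Equiv.refl _)) ?_ ?_, ?_⟩
    · rintro ⟨a, p⟩ ⟨b, q⟩ h
      left
      simpa [edgeRelB] using h
    · rintro ⟨a, p⟩ ⟨b, q⟩ h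
      left
      simpa [edgeRelB] using h
    · simp [graphBIso]
  let σ : Fin 4 ≃ Fin 4 := Equiv.swap 0 1 * Equiv.swap 2 3
  have hflip : ∀ u v : Fin k × Fin 4, edgeRelB k u v →
      edgeRelB k (u.1, σ u.2) (v.1, σ v.2) ∨ edgeRelB k (v.1, σ v.2) (u.1, σ u.2) := by
    rintro ⟨i, p⟩ ⟨j, q⟩ (⟨rfl, h⟩ | ⟨h, hr⟩)
    · rcases h with ⟨rfl, rfl⟩ | ⟨rfl, rfl⟩ | ⟨rfl, rfl⟩ | ⟨rfl, rfl⟩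
      · exact Or.inr (Or.inl ⟨rfl, by dsimp only; decide⟩)
      · exact Or.inr (Or.inl ⟨rfl, by dsimp only; decide⟩)
      · exact Or.inr (Or.inl ⟨rfl, by dsimp only; decide⟩)
      · exact Or.inr (Or.inl ⟨rfl, by dsimp only; decide⟩)
    · rcases h with ⟨rfl, rfl⟩ | ⟨rfl, rfl⟩
      · exact Or.inl (Or.inr ⟨by dsimp only; decide, hr⟩)
      · exact Or.inl (Or.inr ⟨by dsimp only; decide, hr⟩)
  have hneg : ∀ u v : Fin k × Fin 4, edgeRelB k u v →
      edgeRelB k (-u.1, u.2 + 2) (-v.1, v.2 + 2) ∨ edgeRelB k (-v.1, v.2 + 2) (-u.1, u.2 + 2) := by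
    rintro ⟨i, p⟩ ⟨j, q⟩ (⟨rfl, h⟩ | ⟨h, hr⟩)
    · rcases h with ⟨rfl, rfl⟩ | ⟨rfl, rfl⟩ | ⟨rfl, rfl⟩ | ⟨rfl, rfl⟩
      · exact Or.inl (Or.inl ⟨rfl, by dsimp only; decide⟩)
      · exact Or.inl (Or.inl ⟨rfl, by dsimp only; decide⟩)
      · exact Or.inl (Or.inl ⟨rfl, by dsimp only; decide⟩)
      · exact Or.inl (Or.inl ⟨rfl, by dsimp only; decide⟩)
    · have hr' : 1 ≤ (-i - -j : Fin k).val ∧ (-i - -j : Fin k).val ≤ (k - 1) / 2 := by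
        rw [neg_sub_neg]; exact hr
      rcases h with ⟨rfl, rfl⟩ | ⟨rfl, rfl⟩
      · exact Or.inr (Or.inr ⟨by dsimp only; decide, hr'⟩)
      · exact Or.inr (Or.inr ⟨by dsimp only; decide, hr'⟩)
  have hRflip : ∀ i p, R (i, p) (i, σ p) := fun i p =>
    ⟨graphBIso ⟨fun u => (u.1, σ u.2), fun u => (u.1, σ u.2),
      fun u => Prod.ext rfl ((by decide : ∀ p, σ (σ p) = p) u.2),
      fun u => Prod.ext rfl ((by decide : ∀ p, σ (σ p) = p) u.2)⟩ hflip hflip, rfl⟩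
  have hRneg : ∀ i p, R (i, p) (-i, p + 2) := fun i p =>
    ⟨graphBIso ⟨fun u => (-u.1, u.2 + 2), fun u => (-u.1, u.2 + 2),
      fun u => Prod.ext (neg_neg _) ((by decide : ∀ p : Fin 4, p + 2 + 2 = p) u.2),
      fun u => Prod.ext (neg_neg _) ((by decide : ∀ p : Fin 4, p + 2 + 2 = p) u.2)⟩ hneg hneg, rfl⟩
  have hzero : ∀ u, R u (0, 0) := by
    rintro ⟨i, p⟩
    fin_cases p
    · exact hrot i 0 0
    · exact htrans _ _ _ (hRflip i 1) (hrot i 0 0)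
    · exact htrans _ _ _ (hRneg i 2) (hrot (-i) 0 0)
    · exact htrans _ _ _ (hRflip i 3) (htrans _ _ _ (hRneg i 2) (hrot (-i) 0 0))
  exact fun u v => htrans _ _ _ (hzero u) (hsymm _ _ (hzero v))

end GraphB

theorem theorem5p9 :
    (∀ k : ℕ, Odd k → 3 ≤ k →
      Nat.card (Fin k × Fin 4) = 4 * k ∧
      (graphB k).IsVertexTransitive ∧
      k - 2 ≤ (graphB k).lsPlusRank) ∧
    (∀ l : ℕ, 1 ≤ l →
      ∃ n : ℕ, n ≤ 4 * l + 12 ∧ ∃ G : SimpleGraph (Fin n),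
        G.IsVertexTransitive ∧ l ≤ G.lsPlusRank) := by
  refine ⟨fun k hk hk3 => ⟨by simp [mul_comm], isVertexTransitive_graphB hk3,
    le_lsPlusRank_graphB hk hk3⟩, fun l hl => ?_⟩
  -- `k = l + 2` would suffice; parity may force `l + 3`, whence the bound `4 * l + 12`.
  obtain ⟨k, hk, hlk, hkl⟩ : ∃ k, Odd k ∧ l + 2 ≤ k ∧ k ≤ l + 3 := by
    rcases Nat.even_or_odd l with h | h
    · exact ⟨l + 3, h.add_odd (by decide), by omega, le_rfl⟩
    · exact ⟨l + 2, h.add_even (by decide), le_rfl, by omega⟩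
  have e : graphB k ≃g (graphB k).map (finProdFinEquiv : Fin k × Fin 4 ≃ Fin (k * 4)).toEmbedding :=
    SimpleGraph.Iso.map _ _
  refine ⟨k * 4, by omega, _, (isVertexTransitive_graphB (by omega)).of_iso e, ?_⟩
  rw [SimpleGraph.lsPlusRank_eq_of_iso e]
  have := le_lsPlusRank_graphB hk (by omega)
  omega
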